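/- Let $k$ be a finite field with $q$ elements, $v=\sqrt q\in\mathbb C$, and let $\mathscr A$ be a $k$-linear abelian category such that all $\mathrm{Hom}(X,Y)$ and $\mathrm{Ext}^1(X,Y)$ are finite dimensional over $k$, $\mathrm{Ext}^n(X,Y)=0$ for all $n\ge 2$, and every object has a composition series of finite length. Let $\mathcal P$ be the set of isomorphism classes of objects, with representatives $M_\alpha$ ($\alpha\in\mathcal P$), and $I\subseteq\mathcal P$ the set of isomorphism classes of simple objects. The dimension vector $\underline{\dim}\,M\in\mathbb N I\subseteq\mathbb Z I$ of an object $M$ records the multiplicities of the simple objects in a composition series. Put $a_\alpha=|\mathrm{Aut}(M_\alpha)|$, let $g^\gamma_{\alpha\beta}$ be the number of subobjects $X\subseteq M_\gamma$ with $X\cong M_\beta$ and $M_\gamma/X\cong M_\alpha$, let $\langle\alpha,\beta\rangle=\dim_k\mathrm{Hom}(M_\alpha,M_\beta)-\dim_k\mathrm{Ext}^1(M_\alpha,M_\beta)$, and let $(-,-)$ be the bilinear form on $\mathbb Z I$ with $(i,j)=\langle i,j\rangle+\langle j,i\rangle$ for $i,j\in I$; in expressions such as $(\mu,\alpha)$ the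 class $\alpha$ stands for $\underline{\dim}\,M_\alpha$. The Ringel-Hall algebras $\mathcal H^{\pm}$ are the $\mathbb C$-algebras with basis $\{K_\mu u^\pm_\alpha:\mu\in\mathbb Z I,\ \alpha\in\mathcal P\}$ and product given by $$u^\pm_\alpha u^\pm_\beta=v^{\langle\alpha,\beta\rangle}\sum_{\gamma}g^\gamma_{\alpha\beta}u^\pm_\gamma,\qquad K_\mu K_\nu=K_{\mu+\nu},\qquad K_\mu u^\pm_\alpha=v^{\pm(\mu,\alpha)}u^\pm_\alpha K_\mu ,$$ and $\varphi:\mathcal H^+\times\mathcal H^-\to\mathbb C$ is the bilinear form with $$\varphi(K_\mu u^+_\alpha,K_\nu u^-_\beta)=v^{-(\mu,\nu)-(\alpha,\nu)+(\mu,\beta)}\,\frac{\delta_{\alpha\beta}}{a_\alpha}.$$ For $\theta\in\mathbb N I$ let $\mathfrak h^\pm_{\pm\theta}$ be the span of the $u^\pm_\alpha$ with $\underline{\dim}\,M_\alpha=\theta$. Let $\Xi^\pm_\theta=\mathfrak h^\pm_{\pm\theta}$ if $\theta=0$ or $\theta\in I$, and otherwise let $\Xi^\pm_\theta$ be the linear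 span of all products $xy$ with $x\in\mathfrak h^\pm_{\pm\mu}$, $y\in\mathfrak h^\pm_{\pm\nu}$, where $\mu,\nu\in\mathbb N I$, $\mu+\nu=\theta$ and $\mu,\nu\ne\theta$. Set $$L^+_\theta=\{x\in\mathfrak h^+_\theta:\varphi(x,\Xi^-_\theta)=0\},\qquad L^-_\theta=\{y\in\mathfrak h^-_{-\theta}:\varphi(\Xi^+_\theta,y)=0\}.$$ Let $C_0=(c_{ij})_{i,j\in I}$ be the Borcherds-Cartan matrix with $c_{ij}=2(i,j)/(i,i)$ if $(i,i)>0$ and $c_{ij}=(i,j)$ otherwise, let $I^{re}=\{i\in I:c_{ii}=2\}$, $I^{im}=\{i\in I:c_{ii}\le 0\}$, and let $$\mathcal F_0=\{0\ne\mu\in\mathbb N I:\ (\mu,i)\le 0\ \text{for all } i\in I^{re},\ \mathrm{supp}(\mu)\text{ connected}\}\setminus\bigcup_{s\ge 2}sI^{im}$$ be the fundamental region of the generalized Kac-Moody Lie algebra $\mathfrak g(C_0)$, where $\mathrm{supp}(\mu)$ is regarded as a full subgraph of the graph on $I$ in which distinct $i,j$ are joined if $(i,j)\ne 0$. Then for every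 nonzero $\theta\in\mathbb N I$ with $\theta\notin\mathcal F_0\cup\bigcup_{s\ge 2}sI^{im}$ one has $L^+_\theta=0$ and $L^-_\theta=0$. -/

import Mathlib

open CategoryTheory CategoryTheory.Limits CategoryTheory.Abelian

universe t w v u

/-! ## Borcherds data -/

namespace BorcherdsDatum

/-- The bilinear form on `ℤ ι` with values `B i j` on the basis `ι`. -/
def form {ι : Type*} (B : ι → ι → ℤ) (μ ν : ι →₀ ℤ) : ℤ :=
  μ.sum fun i a => ν.sum fun j b => a * b * B i j

/-- The Borcherds-Cartan matrix of a generalized Kac-Moody bilinear form: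
`2 (i,j) / (i,i)` if `(i,i) > 0`, and `(i,j)` otherwise. -/
def cartanMatrix {ι : Type*} (B : ι → ι → ℤ) (i j : ι) : ℚ :=
  if 0 < B i i then 2 * (B i j : ℚ) / (B i i : ℚ) else (B i j : ℚ)

/-- Indices of real simple roots, `ι^re`. -/
def realIndices {ι : Type*} (B : ι → ι → ℤ) : Set ι := {i | cartanMatrix B i i = 2}

/-- Indices of imaginary simple roots, `ι^im`. -/
def imagIndices {ι : Type*} (B : ι → ι → ℤ) : Set ι := {i | cartanMatrix B i i ≤ 0}

/-- The graph on `ι` joining distinct `i`, `j` whenever `(i,j) ≠ 0`. -/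
def graph {ι : Type*} (B : ι → ι → ℤ) : SimpleGraph ι :=
  SimpleGraph.fromRel fun i j => B i j ≠ 0

/-- The inclusion of `ℕ ι` in `ℤ ι`. -/
noncomputable def toInt {ι : Type*} (μ : ι →₀ ℕ) : ι →₀ ℤ :=
  μ.mapRange (fun n : ℕ => (n : ℤ)) Nat.cast_zero

/-- The set `⋃_{s ≥ 2} s ι^im` of proper multiples of imaginary simple roots. -/
def imagMultiples {ι : Type*} (B : ι → ι → ℤ) : Set (ι →₀ ℕ) :=
  {μ | ∃ s : ℕ, 2 ≤ s ∧ ∃ i ∈ imagIndices B, μ = Finsupp.single i s}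

/-- The fundamental region of the generalized Kac-Moody Lie algebra attached to `B`. -/
def fundamentalRegion {ι : Type*} (B : ι → ι → ℤ) : Set (ι →₀ ℕ) :=
  {μ | μ ≠ 0 ∧ (∀ i ∈ realIndices B, form B (toInt μ) (Finsupp.single i 1) ≤ 0) ∧
      ((graph B).induce {i | i ∈ μ.support}).Connected} \ imagMultiples B

end BorcherdsDatum

/-! ## Ringel-Hall algebras -/

namespace RingelHall


/-- The isomorphism classes of objects of `C`. -/
abbrev IsoClass (C : Type u) [Category.{v} C] : Type u := Quotient (isIsomorphicSetoid C)

/-- A representative object `M_α` of the class `α`. -/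
noncomputable def IsoClass.obj {C : Type u} [Category.{v} C] (α : IsoClass C) : C :=
  Quotient.out α

/-- The isomorphism classes of simple objects of `C`. -/
abbrev SimpleClass (C : Type u) [Category.{v} C] [Abelian C] : Type u :=
  {α : IsoClass C // Simple α.obj}

/-- `HasCompFactors M d`: the object `M` has a composition series of finite length in which
each simple object `S_i` occurs exactly `d i` times as a factor. -/
inductive HasCompFactors {C : Type u} [Category.{v} C] [Abelian C] :
    C → (SimpleClass C →₀ ℕ) → Prop
  | zero {M : C} (hM : IsZero M) : HasCompFactors M 0
  | step {L M : C} {d : SimpleClass C →₀ ℕ} (f : L ⟶ M) (hf : Mono f) (i : SimpleClass C)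
      (e : cokernel f ≅ i.1.obj) (hL : HasCompFactors L d) :
      HasCompFactors M (d + Finsupp.single i 1)

/-- `C` is a length category: every object has a composition series of finite length. -/
def IsLengthCategory (C : Type u) [Category.{v} C] [Abelian C] : Prop :=
  ∀ M : C, ∃ d : SimpleClass C →₀ ℕ, HasCompFactors M d

open scoped Classical in
/-- The dimension vector of an object, for objects of finite length
(it is independent of the composition series by Jordan-Hölder). -/
noncomputable def dimVec {C : Type u} [Category.{v} C] [Abelian C] (M : C) :
    SimpleClass C →₀ ℕ :=
  if h : ∃ d, HasCompFactors M d then h.choose else 0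

/-- The Ringel-Hall number `g^γ_{αβ}`: the number of subobjects `X` of `M_γ` with
`X ≅ M_β` and `M_γ / X ≅ M_α`. -/
noncomputable def hallNumber {C : Type u} [Category.{v} C] [Abelian C] (α β γ : IsoClass C) : ℕ :=
  Nat.card {X : Subobject γ.obj //
    Nonempty ((X : C) ≅ β.obj) ∧ Nonempty (cokernel X.arrow ≅ α.obj)}

/-- `a_α`, the order of the automorphism group of `M_α`. -/
noncomputable def autCard {C : Type u} [Category.{v} C] (α : IsoClass C) : ℕ :=
  Nat.card (Aut α.obj)

section

variable (k : Type t) [Field k] {C : Type u} [Category.{v} C] [Abelian C] [Linear k C]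
  [HasExt.{w} C]

/-- The Euler form `⟨α, β⟩ = dim Hom(M_α, M_β) - dim Ext¹(M_α, M_β)`. -/
noncomputable def euler (α β : IsoClass C) : ℤ :=
  (Module.finrank k (α.obj ⟶ β.obj) : ℤ) - (Module.finrank k (Ext.{w} α.obj β.obj 1) : ℤ)

/-- The symmetric Euler form `(i, j) = ⟨i, j⟩ + ⟨j, i⟩` on simple classes. -/
noncomputable def symEuler (i j : SimpleClass C) : ℤ :=
  euler.{t, w} k i.1 j.1 + euler.{t, w} k j.1 i.1

/-- The symmetric Euler form on the Grothendieck group `ℤ I`. -/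
noncomputable def symForm (μ ν : SimpleClass C →₀ ℤ) : ℤ :=
  BorcherdsDatum.form (symEuler.{t, w} k) μ ν

/-- The class of `M_α` in the Grothendieck group `ℤ I`. -/
noncomputable def cls (α : IsoClass C) : SimpleClass C →₀ ℤ :=
  BorcherdsDatum.toInt (dimVec α.obj)

/-- `v = √q` with `q` the number of elements of `k`, as a complex number. -/
noncomputable def vParam : ℂ := ((Real.sqrt (Nat.card k : ℝ) : ℝ) : ℂ)

variable (C)

/-- The underlying space of the positive Ringel-Hall algebra; the basis vector
at `(μ, α)` is `K_μ u_α⁺`. -/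
abbrev HallPos : Type u := ((SimpleClass C →₀ ℤ) × IsoClass C) →₀ ℂ

/-- The underlying space of the negative Ringel-Hall algebra; the basis vector
at `(μ, α)` is `K_μ u_α⁻`. -/
abbrev HallNeg : Type u := ((SimpleClass C →₀ ℤ) × IsoClass C) →₀ ℂ

variable {C}

/-- The basis vector `u_α⁺`. -/
noncomputable def uPos (α : IsoClass C) : HallPos C := Finsupp.single (0, α) 1

/-- The basis vector `u_α⁻`. -/
noncomputable def uNeg (α : IsoClass C) : HallNeg C := Finsupp.single (0, α) 1

/-- The product of the positive Ringel-Hall algebra, determined by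
`u_α u_β = v^⟨α,β⟩ ∑_γ g^γ_{αβ} u_γ`, `K_μ K_ν = K_{μ+ν}` and `K_ν u_α = v^(ν,α) u_α K_ν`:
`(K_μ u_α)(K_ν u_β) = v^(-(ν,α)) v^⟨α,β⟩ ∑_γ g^γ_{αβ} K_{μ+ν} u_γ`.
The sum has finitely many nonzero terms when all Hom and Ext¹ spaces are finite. -/
noncomputable def mulPos : HallPos C →ₗ[ℂ] HallPos C →ₗ[ℂ] HallPos C :=
  Finsupp.linearCombination ℂ fun p => Finsupp.linearCombination ℂ fun q =>
    (vParam k ^ (-symForm.{t, w} k q.1 (cls p.2)) * vParam k ^ euler.{t, w} k p.2 q.2) •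
      ∑ᶠ γ : IsoClass C,
        (Finsupp.single (p.1 + q.1, γ) (hallNumber p.2 q.2 γ : ℂ) : HallPos C)

/-- The product of the negative Ringel-Hall algebra, determined by
`u_α u_β = v^⟨α,β⟩ ∑_γ g^γ_{αβ} u_γ`, `K_μ K_ν = K_{μ+ν}` and `K_ν u_α = v^(-(ν,α)) u_α K_ν`:
`(K_μ u_α)(K_ν u_β) = v^(ν,α) v^⟨α,β⟩ ∑_γ g^γ_{αβ} K_{μ+ν} u_γ`. -/
noncomputable def mulNeg : HallNeg C →ₗ[ℂ] HallNeg C →ₗ[ℂ] HallNeg C :=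
  Finsupp.linearCombination ℂ fun p => Finsupp.linearCombination ℂ fun q =>
    (vParam k ^ symForm.{t, w} k q.1 (cls p.2) * vParam k ^ euler.{t, w} k p.2 q.2) •
      ∑ᶠ γ : IsoClass C,
        (Finsupp.single (p.1 + q.1, γ) (hallNumber p.2 q.2 γ : ℂ) : HallNeg C)

open scoped Classical in
/-- The bilinear pairing `φ` with
`φ(K_μ u_α⁺, K_ν u_β⁻) = v^(-(μ,ν)-(α,ν)+(μ,β)) δ_{αβ} / a_α`. -/
noncomputable def pairing : HallPos C →ₗ[ℂ] HallNeg C →ₗ[ℂ] ℂ :=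
  Finsupp.linearCombination ℂ fun p => Finsupp.linearCombination ℂ fun q =>
    vParam k ^ (-symForm.{t, w} k p.1 q.1 - symForm.{t, w} k (cls p.2) q.1
        + symForm.{t, w} k p.1 (cls q.2)) *
      (if p.2 = q.2 then 1 / (autCard p.2 : ℂ) else 0)

/-- The homogeneous space of degree `θ` of the subalgebra `𝔥⁺` generated by the `u_α⁺`;
it has basis `u_α⁺` for `α` of dimension vector `θ`. -/
noncomputable def hPos (θ : SimpleClass C →₀ ℕ) : Submodule ℂ (HallPos C) :=
  Submodule.span ℂ {x | ∃ α : IsoClass C, dimVec α.obj = θ ∧ x = uPos α}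

/-- The homogeneous space of degree `-θ` of the subalgebra `𝔥⁻` generated by the `u_α⁻`;
it has basis `u_α⁻` for `α` of dimension vector `θ`. -/
noncomputable def hNeg (θ : SimpleClass C →₀ ℕ) : Submodule ℂ (HallNeg C) :=
  Submodule.span ℂ {x | ∃ α : IsoClass C, dimVec α.obj = θ ∧ x = uNeg α}

open scoped Classical in
/-- `Ξ_θ⁺`: all of `𝔥⁺_θ` if `θ` is zero or a basis element, and otherwise
`∑ 𝔥⁺_μ 𝔥⁺_ν` over all decompositions `θ = μ + ν` with `μ, ν ≠ θ`. -/
noncomputable def XiPos (θ : SimpleClass C →₀ ℕ) : Submodule ℂ (HallPos C) :=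
  if θ = 0 ∨ ∃ i, θ = Finsupp.single i 1 then hPos θ
  else Submodule.span ℂ {z | ∃ μ ν : SimpleClass C →₀ ℕ, μ + ν = θ ∧ μ ≠ θ ∧ ν ≠ θ ∧
    ∃ x ∈ hPos μ, ∃ y ∈ hPos ν, z = mulPos.{t, w} k x y}

open scoped Classical in
/-- `Ξ_θ⁻`, the analogue of `Ξ_θ⁺` in `𝔥⁻`. -/
noncomputable def XiNeg (θ : SimpleClass C →₀ ℕ) : Submodule ℂ (HallNeg C) :=
  if θ = 0 ∨ ∃ i, θ = Finsupp.single i 1 then hNeg θ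
  else Submodule.span ℂ {z | ∃ μ ν : SimpleClass C →₀ ℕ, μ + ν = θ ∧ μ ≠ θ ∧ ν ≠ θ ∧
    ∃ x ∈ hNeg μ, ∃ y ∈ hNeg ν, z = mulNeg.{t, w} k x y}

/-- `L_θ⁺ = {x ∈ 𝔥⁺_θ : φ(x, Ξ_θ⁻) = 0}`. -/
noncomputable def LPos (θ : SimpleClass C →₀ ℕ) : Submodule ℂ (HallPos C) where
  carrier := {x | x ∈ hPos θ ∧ ∀ y ∈ XiNeg.{t, w} k θ, pairing.{t, w} k x y = 0}
  add_mem' := fun ha hb => ⟨add_mem ha.1 hb.1, fun y hy => by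
    simp [ha.2 y hy, hb.2 y hy]⟩
  zero_mem' := ⟨zero_mem _, fun y _ => by simp⟩
  smul_mem' := fun c x hx => ⟨Submodule.smul_mem _ c hx.1, fun y hy => by
    simp [hx.2 y hy]⟩

/-- `L_θ⁻ = {y ∈ 𝔥⁻_{-θ} : φ(Ξ_θ⁺, y) = 0}`. -/
noncomputable def LNeg (θ : SimpleClass C →₀ ℕ) : Submodule ℂ (HallNeg C) where
  carrier := {y | y ∈ hNeg θ ∧ ∀ x ∈ XiPos.{t, w} k θ, pairing.{t, w} k x y = 0}
  add_mem' := fun ha hb => ⟨add_mem ha.1 hb.1, fun x hx => by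
    simp [ha.2 x hx, hb.2 x hx]⟩
  zero_mem' := ⟨zero_mem _, fun x _ => by simp⟩
  smul_mem' := fun c y hy => ⟨Submodule.smul_mem _ c hy.1, fun x hx => by
    simp [hy.2 x hx]⟩

end

end RingelHall

/-!
The pairing `φ` is diagonal in the bases `u_α⁺`, `u_α⁻`, so an element of `L^±_θ` is a finitely
supported function `f` on the isomorphism classes of dimension vector `θ` such that
`∑_γ f(γ) g^γ_{αβ} / a_γ = 0` for all `α`, `β` whose dimension vectors are different from `θ` and
add up to `θ`. Real and imaginary parts satisfy the same conditions, so `f` may be taken real. If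
`θ` is simple, `φ` is nondegenerate on the degree `θ` part and nothing is left to prove. If `θ` is
not simple and lies outside the fundamental region, then either its support is disconnected or
`(θ, i) > 0` for some simple class `i`.

*Disconnected support* (`eq_zero_of_not_connected`). There are no extensions between simple objects
in different components, so an object `M` of dimension vector `θ` is an extension of some `Y` by
some `X` with `X`, `Y` nonzero and `Ext¹(Y, X) = 0`. All extensions of `Y` by `X` being isomorphic
to `M`, orthogonality to the product of the classes of `Y` and `X` gives `f(M) = 0`.

*A simple object `S` with `(θ, S) > 0`* (`eq_zero_of_orthogonal`). Put
`R(E) = ∑_{S ↪ E} f(E / S)` and `L(E) = ∑_{E ↠ S} f(ker)`, the products of `f` with the class of `S`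
on the two sides, and consider the inner product `⟨F, G⟩ = ∑_E F(E) G(E) / a_E` and
`N = ∑_γ f(γ)² / a_γ`. Let `a` be the order of `Aut S`.
* `⟨R, R⟩ = a r N` with `r = |Ext¹(γ, S)| / |Hom(γ, S)|`, which depends on `θ` only. A pair of
  embeddings of `S` into `E` with different images spans a subobject `S ⊕ S`; then `E` is a fibre
  product, and orthogonality makes the contribution of such pairs vanish. The pairs with the same
  image contribute the number of extensions of `γ` by `S`, weighted by `1 / a_E`, which Riedtmann's
  formula (`sum_wt_mul_card_ses`) computes.
* Dually `⟨L, L⟩ = a l N` with `l = |Ext¹(S, γ)| / |Hom(S, γ)|`.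
* `⟨R, L⟩ = a N`. A pair `S ↪ E ↠ S` with nonzero composition splits `E` as `γ ⊕ S`, and these
  pairs give `a N`. The pairs with zero composition contribute zero: as `Ext²(S, S) = 0`, the
  extensions of `γ` by `S` restrict onto those of the kernel of `γ ↠ S`, and orthogonality applies.

By additivity of the Euler form (`HasCompFactors.form_eq`), `r l = q ^ (-(θ, S)) < 1`, whereas the
Cauchy-Schwarz inequality says `N² ≤ r l N²`. Hence `N = 0`, that is `f = 0`.

Short exact sequences are related to `Ext¹` through two facts: sequences with the same extension
class are equivalent (`IsSES.exists_iso_of_extClass_eq`), and each class in `Ext¹` is the class of a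
sequence (`exists_extClass_eq`), obtained from a distinguished triangle in the derived category. The
numerical statements also need the Jordan-Hölder theorem (`HasCompFactors.unique`).
-/

namespace RingelHall

/-! ### Short exact sequences -/

section ShortExactSequences

variable {C : Type u} [Category.{v} C] [Abelian C]

/-- The pair of composable morphisms `ι : X ⟶ E`, `π : E ⟶ Y` is a short exact sequence
`0 ⟶ X ⟶ E ⟶ Y ⟶ 0`. -/
def IsSES {X E Y : C} (ι : X ⟶ E) (π : E ⟶ Y) : Prop :=
  ∃ w : ι ≫ π = 0, (ShortComplex.mk ι π w).ShortExact

namespace IsSES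

variable {X E Y : C} {ι : X ⟶ E} {π : E ⟶ Y}

lemma zero (h : IsSES ι π) : ι ≫ π = 0 := h.1

lemma mono (h : IsSES ι π) : Mono ι := h.2.mono_f

lemma epi (h : IsSES ι π) : Epi π := h.2.epi_g

lemma exists_lift (h : IsSES ι π) {T : C} (t : T ⟶ E) (ht : t ≫ π = 0) : ∃ s, s ≫ ι = t := by
  have := h.mono
  exact ⟨h.2.exact.lift t ht, h.2.exact.lift_f t ht⟩

lemma exists_desc (h : IsSES ι π) {T : C} (t : E ⟶ T) (ht : ι ≫ t = 0) : ∃ s, π ≫ s = t := by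
  have := h.epi
  exact ⟨h.2.exact.desc t ht, h.2.exact.g_desc t ht⟩

lemma of_lift [Mono ι] [Epi π] (w : ι ≫ π = 0)
    (h : ∀ {T : C} (t : T ⟶ E), t ≫ π = 0 → ∃ s, s ≫ ι = t) : IsSES ι π := by
  refine ⟨w, { exact := ShortComplex.exact_of_f_is_kernel _ ?_, mono_f := ‹_›, epi_g := ‹_› }⟩
  exact KernelFork.IsLimit.ofι' _ _ fun t ht => ⟨(h t ht).choose, (h t ht).choose_spec⟩

lemma of_desc [Mono ι] [Epi π] (w : ι ≫ π = 0)
    (h : ∀ {T : C} (t : E ⟶ T), ι ≫ t = 0 → ∃ s, π ≫ s = t) : IsSES ι π := by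
  refine ⟨w, { exact := ShortComplex.exact_of_g_is_cokernel _ ?_, mono_f := ‹_›, epi_g := ‹_› }⟩
  exact CokernelCofork.IsColimit.ofπ' _ _ fun t ht => ⟨(h t ht).choose, (h t ht).choose_spec⟩

lemma cokernel (ι : X ⟶ E) [Mono ι] : IsSES ι (cokernel.π ι) :=
  of_desc (cokernel.condition ι) fun t ht => ⟨cokernel.desc ι t ht, cokernel.π_desc _ _ _⟩

lemma kernel (π : E ⟶ Y) [Epi π] : IsSES (kernel.ι π) π :=
  of_lift (kernel.condition π) fun t ht => ⟨kernel.lift π t ht, kernel.lift_ι _ _ _⟩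

lemma comp_iso (h : IsSES ι π) {Y' : C} (φ : Y ⟶ Y') [IsIso φ] : IsSES ι (π ≫ φ) := by
  have := h.mono
  have := h.epi
  refine of_lift (by rw [← Category.assoc, h.zero, zero_comp]) fun t ht => h.exists_lift t ?_
  rw [← cancel_mono φ, Category.assoc, ht, zero_comp]

lemma iso_comp (h : IsSES ι π) {X' : C} (φ : X' ⟶ X) [IsIso φ] : IsSES (φ ≫ ι) π := by
  have := h.mono
  have := h.epi
  refine of_desc (by rw [Category.assoc, h.zero, comp_zero]) fun t ht => h.exists_desc t ?_
  rw [← cancel_epi φ, ← Category.assoc, ht, comp_zero]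

lemma middle_iso (h : IsSES ι π) {E' : C} (φ : E ≅ E') : IsSES (ι ≫ φ.hom) (φ.inv ≫ π) := by
  have := h.mono
  have := h.epi
  refine of_lift (by simp [h.zero]) fun t ht => ?_
  obtain ⟨s, hs⟩ := h.exists_lift (t ≫ φ.inv) (by simpa using ht)
  exact ⟨s, by rw [← Category.assoc, hs]; simp⟩

lemma exists_iso_right (h : IsSES ι π) {Y' : C} {π' : E ⟶ Y'} (h' : IsSES ι π') :
    ∃ φ : Y ≅ Y', π ≫ φ.hom = π' := by
  obtain ⟨a, ha⟩ := h.exists_desc π' h'.zero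
  obtain ⟨b, hb⟩ := h'.exists_desc π h.zero
  have := h.epi
  have := h'.epi
  refine ⟨⟨a, b, ?_, ?_⟩, ha⟩
  · rw [← cancel_epi π, ← Category.assoc, ha, hb, Category.comp_id]
  · rw [← cancel_epi π', ← Category.assoc, hb, ha, Category.comp_id]

lemma exists_iso_left (h : IsSES ι π) {X' : C} {ι' : X' ⟶ E} (h' : IsSES ι' π) :
    ∃ φ : X' ≅ X, φ.hom ≫ ι = ι' := by
  obtain ⟨a, ha⟩ := h.exists_lift ι' h'.zero
  obtain ⟨b, hb⟩ := h'.exists_lift ι h.zero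
  have := h.mono
  have := h'.mono
  refine ⟨⟨a, b, ?_, ?_⟩, ha⟩
  · rw [← cancel_mono ι', Category.assoc, hb, ha, Category.id_comp]
  · rw [← cancel_mono ι, Category.assoc, ha, hb, Category.id_comp]

/-- A morphism of extensions of `Y` by `X` is an isomorphism. -/
lemma isIso_of_comp (h : IsSES ι π) {E' : C} {ι' : X ⟶ E'} {π' : E' ⟶ Y} (h' : IsSES ι' π')
    (c : E ⟶ E') (hc₁ : ι ≫ c = ι') (hc₂ : c ≫ π' = π) : IsIso c :=
  ShortComplex.isIso₂_of_shortExact_of_isIso₁₃'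
    (S₁ := ShortComplex.mk ι π h.zero) (S₂ := ShortComplex.mk ι' π' h'.zero)
    ⟨𝟙 X, c, 𝟙 Y, by simp [hc₁], by simp [hc₂]⟩ h.2 h'.2 (by dsimp; infer_instance)
      (by dsimp; infer_instance)

end IsSES

end ShortExactSequences

/-! ### Extension classes -/

section ExtensionClasses

variable {C : Type u} [Category.{v} C] [Abelian C] [HasExt.{w} C]

/-- The class in `Ext¹(Y, X)` of a short exact sequence `0 ⟶ X ⟶ E ⟶ Y ⟶ 0`. -/
noncomputable def IsSES.extClass {X E Y : C} {ι : X ⟶ E} {π : E ⟶ Y} (h : IsSES ι π) :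
    Ext.{w} Y X 1 :=
  h.2.extClass

lemma IsSES.extClass_naturality {X E Y X' E' Y' : C} {ι : X ⟶ E} {π : E ⟶ Y} {ι' : X' ⟶ E'}
    {π' : E' ⟶ Y'} (h : IsSES ι π) (h' : IsSES ι' π') (a : X ⟶ X') (b : E ⟶ E') (c : Y ⟶ Y')
    (hab : a ≫ ι' = ι ≫ b) (hbc : b ≫ π' = π ≫ c) :
    h.extClass.comp (Ext.mk₀ a) (add_zero 1) =
      (Ext.mk₀ c).comp h'.extClass.{w} (zero_add 1) :=
  ShortComplex.ShortExact.extClass_naturality h.2 h'.2 ⟨a, b, c, hab, hbc⟩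

/-- Short exact sequences with the same extension class are equivalent. -/
lemma IsSES.exists_iso_of_extClass_eq {X E Y E' : C} {ι : X ⟶ E} {π : E ⟶ Y} {ι' : X ⟶ E'}
    {π' : E' ⟶ Y} (h : IsSES ι π) (h' : IsSES ι' π') (he : h.extClass.{w} = h'.extClass.{w}) :
    ∃ φ : E ≅ E', ι ≫ φ.hom = ι' ∧ φ.inv ≫ π = π' := by
  -- `π` lifts along `π'` because the pullback of the extension `E'` along `π` splits.
  have h0 : (Ext.mk₀ π).comp h'.extClass.{w} (zero_add 1) = 0 := by
    rw [← he]; exact h.2.comp_extClass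
  obtain ⟨x, hx⟩ := Ext.covariant_sequence_exact₃ E h'.2 (Ext.mk₀ π) (zero_add 1) h0
  obtain ⟨b, rfl⟩ := (Ext.mk₀_bijective E E').2 x
  rw [Ext.mk₀_comp_mk₀] at hx
  have hb : b ≫ π' = π := (Ext.mk₀_bijective _ _).1 hx
  obtain ⟨a, ha⟩ := h'.exists_lift (ι ≫ b) (by rw [Category.assoc, hb, h.zero])
  -- The lift induces `a` on `X`; it can be corrected so that `a` becomes the identity.
  have h1 := h.extClass_naturality.{w} h' a b (𝟙 Y) ha (by rw [hb, Category.comp_id])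
  rw [Ext.mk₀_id_comp, ← he] at h1
  have h2 : h.extClass.{w}.comp (Ext.mk₀ (a - 𝟙 X)) (add_zero 1) = 0 := by
    rw [sub_eq_add_neg, Ext.mk₀_add, Ext.comp_add, h1, Ext.mk₀_neg, Ext.comp_neg, Ext.comp_mk₀_id,
      add_neg_cancel]
  obtain ⟨y, hy⟩ := Ext.contravariant_sequence_exact₁ h.2 X (Ext.mk₀ (a - 𝟙 X)) (add_zero 1) h2
  obtain ⟨r, rfl⟩ := (Ext.mk₀_bijective E X).2 y
  rw [Ext.mk₀_comp_mk₀] at hy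
  have hr : ι ≫ r = a - 𝟙 X := (Ext.mk₀_bijective _ _).1 hy
  let c : E ⟶ E' := b - r ≫ ι'
  have hc1 : ι ≫ c = ι' := by
    simp only [c, Preadditive.comp_sub, ← Category.assoc, hr, ← ha, Preadditive.sub_comp,
      Category.id_comp, sub_sub_cancel]
  have hc2 : c ≫ π' = π := by
    simp only [c, Preadditive.sub_comp, hb, Category.assoc, h'.zero, comp_zero, sub_zero]
  have : IsIso c := h.isIso_of_comp h' c hc1 hc2
  exact ⟨asIso c, hc1, by rw [Iso.inv_comp_eq]; exact hc2.symm⟩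

end ExtensionClasses

section Realization

variable {C : Type u} [Category.{v} C] [Abelian C]

open DerivedCategory Pretriangulated in
/-- Morphisms of `C` that are the first two maps of a distinguished triangle on complexes
concentrated in degree zero form a short exact sequence. -/
lemma IsSES.of_distinguished [HasDerivedCategory.{t} C] {X E Y : C} (ι : X ⟶ E) (π : E ⟶ Y)
    (δ : (singleFunctor C 0).obj Y ⟶ ((singleFunctor C 0).obj X)⟦(1 : ℤ)⟧)
    (h : Triangle.mk ((singleFunctor C 0).map ι) ((singleFunctor C 0).map π) δ ∈
      distTriang (DerivedCategory C)) : IsSES ι π := by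
  have w : ι ≫ π = 0 := by
    apply (singleFunctor C 0).map_injective
    rw [Functor.map_comp, Functor.map_zero]
    exact comp_distTriang_mor_zero₁₂ _ h
  refine ⟨w, ?_⟩
  have hmono : Mono ((homologyFunctor C 0).map ((singleFunctor C 0).map ι)) :=
    (HomologySequence.mono_homologyMap_mor₁_iff _ h (-1) 0 (by lia)).2
      ((isZero_of_isGE ((singleFunctor C 0).obj Y) 0 (-1) (by lia)).eq_of_src _ _)
  have hepi : Epi ((homologyFunctor C 0).map ((singleFunctor C 0).map π)) :=
    (HomologySequence.epi_homologyMap_mor₂_iff _ h 0 1 (by lia)).2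
      ((isZero_of_isLE ((singleFunctor C 0).obj X) 0 1 (by lia)).eq_of_tgt _ _)
  have hex := HomologySequence.exact₂ _ h 0
  let e := singleFunctorCompHomologyFunctorIso C 0
  exact ShortComplex.shortExact_of_iso
    (ShortComplex.isoMk (e.app X) (e.app E) (e.app Y) (e.hom.naturality ι).symm
      (e.hom.naturality π).symm)
    { exact := hex, mono_f := hmono, epi_g := hepi }

open DerivedCategory Pretriangulated in
/-- Every element of `Ext¹(Y, X)` is the class of a short exact sequence: complete the
corresponding morphism `Y ⟶ X[1]` of the derived category to a distinguished triangle, whose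
third object has cohomology in degree zero only. -/
lemma exists_extClass_eq [HasExt.{w} C] {X Y : C} (e : Ext.{w} Y X 1) :
    ∃ (E : C) (ι : X ⟶ E) (π : E ⟶ Y) (h : IsSES ι π), h.extClass = e := by
  let := HasDerivedCategory.standard C
  obtain ⟨E', f, g, hT⟩ := distinguished_cocone_triangle₂
    (Z := (singleFunctor C 0).obj Y) (X := (singleFunctor C 0).obj X) e.hom
  have hge : E'.IsGE 0 := by
    rw [isGE_iff]
    intro i hi
    exact (HomologySequence.exact₂ _ hT i).isZero_of_both_zeros
      ((isZero_of_isGE ((singleFunctor C 0).obj X) 0 i hi).eq_of_src _ _)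
      ((isZero_of_isGE ((singleFunctor C 0).obj Y) 0 i hi).eq_of_tgt _ _)
  have hle : E'.IsLE 0 := by
    rw [isLE_iff]
    intro i hi
    exact (HomologySequence.exact₂ _ hT i).isZero_of_both_zeros
      ((isZero_of_isLE ((singleFunctor C 0).obj X) 0 i hi).eq_of_src _ _)
      ((isZero_of_isLE ((singleFunctor C 0).obj Y) 0 i hi).eq_of_tgt _ _)
  obtain ⟨E, ⟨φ⟩⟩ := exists_iso_singleFunctor_obj_of_isGE_of_isLE E' 0
  obtain ⟨ι, hι⟩ := (singleFunctor C 0).map_surjective (f ≫ φ.hom)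
  obtain ⟨π, hπ⟩ := (singleFunctor C 0).map_surjective (φ.inv ≫ g)
  have hT' : Triangle.mk ((singleFunctor C 0).map ι) ((singleFunctor C 0).map π) e.hom ∈
      distTriang (DerivedCategory C) := by
    refine isomorphic_distinguished _ hT _
      (Triangle.isoMk _ _ (Iso.refl _) φ.symm (Iso.refl _) ?_ ?_ ?_)
    · change (singleFunctor C 0).map ι ≫ φ.inv = 𝟙 _ ≫ f
      rw [hι, Category.assoc, Iso.hom_inv_id, Category.comp_id, Category.id_comp]
    · change (singleFunctor C 0).map π ≫ 𝟙 _ = φ.inv ≫ g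
      rw [hπ, Category.comp_id]
    · change e.hom ≫ (shiftFunctor (DerivedCategory C) (1 : ℤ)).map (𝟙 _) = 𝟙 _ ≫ e.hom
      rw [CategoryTheory.Functor.map_id]
      exact (Category.comp_id _).trans (Category.id_comp _).symm
  have h := IsSES.of_distinguished ι π _ hT'
  refine ⟨E, ι, π, h, ?_⟩
  -- The two distinguished triangles on `ι` and `π` have the same connecting morphism.
  obtain ⟨c, hc₁, hc₂⟩ := complete_distinguished_triangle_morphism _ _
    h.2.singleTriangle_distinguished hT' (𝟙 _) (𝟙 _)
    ((Category.comp_id _).trans (Category.id_comp _).symm)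
  obtain ⟨c, rfl⟩ := (singleFunctor C 0).map_surjective c
  have hc : c = 𝟙 Y := by
    have := h.epi
    rw [← cancel_epi π]
    apply (singleFunctor C 0).map_injective
    rw [Category.comp_id, Functor.map_comp]
    exact hc₁.trans (Category.id_comp _)
  subst hc
  apply Ext.ext
  rw [IsSES.extClass, ShortComplex.ShortExact.extClass_hom]
  have h₁ : (shiftFunctor (DerivedCategory C) (1 : ℤ)).map (𝟙 ((singleFunctor C 0).obj X)) = 𝟙 _ :=
    CategoryTheory.Functor.map_id _ _
  have h₂ : (singleFunctor C 0).map (𝟙 Y) = 𝟙 _ := CategoryTheory.Functor.map_id _ _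
  have h₃ : h.2.singleδ ≫ (shiftFunctor (DerivedCategory C) (1 : ℤ)).map
      (𝟙 ((singleFunctor C 0).obj X)) = (singleFunctor C 0).map (𝟙 Y) ≫ e.hom := hc₂
  rwa [h₁, h₂, Category.comp_id, Category.id_comp] at h₃

end Realization

/-! ### Weighted sums over isomorphism classes -/

section WeightedSums

open scoped Classical

variable {C : Type u} [Category.{v} C]

lemma IsoClass.nonempty_iso_obj (X : C) : Nonempty (X ≅ IsoClass.obj (⟦X⟧ : IsoClass C)) :=
  Nonempty.map Iso.symm (Quotient.exact (Quotient.out_eq (⟦X⟧ : IsoClass C)))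

lemma IsoClass.mk_obj (α : IsoClass C) : (⟦α.obj⟧ : IsoClass C) = α := Quotient.out_eq α

lemma IsoClass.mk_eq_of_iso {X Y : C} (e : X ≅ Y) : (⟦X⟧ : IsoClass C) = ⟦Y⟧ :=
  Quotient.sound ⟨e⟩

lemma IsoClass.eq_of_iso_obj {X : C} {α : IsoClass C} (e : X ≅ α.obj) : (⟦X⟧ : IsoClass C) = α :=
  (IsoClass.mk_eq_of_iso e).trans α.mk_obj

/-- The isomorphisms from `X` to `Y`, as a subtype of the morphisms. -/
abbrev IsoHom (X Y : C) := {φ : X ⟶ Y // IsIso φ}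

/-- The monomorphisms from `X` to `Y`. -/
abbrev MonoHom (X Y : C) := {φ : X ⟶ Y // Mono φ}

/-- The epimorphisms from `X` to `Y`. -/
abbrev EpiHom (X Y : C) := {φ : X ⟶ Y // Epi φ}

/-- The short exact sequences `0 ⟶ X ⟶ E ⟶ Y ⟶ 0` with the three given objects. -/
abbrev SES [Abelian C] (X E Y : C) := {p : (X ⟶ E) × (E ⟶ Y) // IsSES p.1 p.2}

/-- The weight `1 / |Aut M_α|` of an isomorphism class. -/
noncomputable def wt (α : IsoClass C) : ℝ := (autCard α : ℝ)⁻¹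

variable [∀ X Y : C, Finite (X ⟶ Y)]

noncomputable local instance homFintype (X Y : C) : Fintype (X ⟶ Y) := Fintype.ofFinite _

/-- Isomorphisms as invertible morphisms. -/
noncomputable def isoEquivIsoHom (X Y : C) : (X ≅ Y) ≃ IsoHom X Y where
  toFun e := ⟨e.hom, inferInstance⟩
  invFun φ := have := φ.2; asIso φ.1
  left_inv e := by ext; rfl
  right_inv φ := rfl

lemma card_isoHom_self_obj (α : IsoClass C) :
    Fintype.card (IsoHom α.obj α.obj) = autCard α := by
  rw [autCard, ← Nat.card_eq_fintype_card]
  exact (Nat.card_congr ((Equiv.refl (Aut α.obj)).trans (isoEquivIsoHom α.obj α.obj))).symm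

lemma card_isoHom_congr {X X' Y Y' : C} (e : X ≅ X') (e' : Y ≅ Y') :
    Fintype.card (IsoHom X Y) = Fintype.card (IsoHom X' Y') :=
  Fintype.card_congr ((isoEquivIsoHom X Y).symm.trans
    (((Iso.isoCongr e e')).trans (isoEquivIsoHom X' Y')))

lemma card_isoHom_self_pos (X : C) : 0 < Fintype.card (IsoHom X X) :=
  Fintype.card_pos_iff.2 ⟨⟨𝟙 X, inferInstance⟩⟩

lemma autCard_pos (α : IsoClass C) : 0 < autCard α :=
  card_isoHom_self_obj α ▸ card_isoHom_self_pos _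

lemma wt_pos (α : IsoClass C) : 0 < wt α := inv_pos.2 (Nat.cast_pos.2 (autCard_pos α))

/-- Summing over all classes `α` and all isomorphisms `X ≅ M_α`, with the weight `1 / |Aut M_α|`,
picks out the value at the class of `X`. -/
lemma sum_wt_mul_card_isoHom (X : C) (𝓔 : Finset (IsoClass C)) (F : IsoClass C → ℝ)
    (hF : (⟦X⟧ : IsoClass C) ∉ 𝓔 → F ⟦X⟧ = 0) :
    ∑ α ∈ 𝓔, wt α * F α * Fintype.card (IsoHom X α.obj) = F ⟦X⟧ := by
  have h0 : ∀ α ∈ 𝓔, α ≠ ⟦X⟧ → wt α * F α * Fintype.card (IsoHom X α.obj) = 0 := by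
    intro α _ hα
    have : IsEmpty (IsoHom X α.obj) :=
      ⟨fun φ => hα (IsoClass.eq_of_iso_obj ((isoEquivIsoHom _ _).symm φ)).symm⟩
    simp
  by_cases hX : (⟦X⟧ : IsoClass C) ∈ 𝓔
  · rw [Finset.sum_eq_single_of_mem _ hX h0]
    obtain ⟨e⟩ := IsoClass.nonempty_iso_obj X
    rw [card_isoHom_congr e (Iso.refl _), card_isoHom_self_obj, wt]
    have := (Nat.cast_pos (α := ℝ)).2 (autCard_pos (⟦X⟧ : IsoClass C))
    field_simp
  · rw [hF hX]
    exact Finset.sum_eq_zero fun α hα => h0 α hα fun h => hX (h ▸ hα)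

variable [Abelian C]

/-- The short exact sequences with first map `ι` and quotient `Y` correspond to the isomorphisms from
`cokernel ι` to `Y`. -/
noncomputable def isSESRightEquiv {X E : C} (ι : X ⟶ E) [Mono ι] (Y : C) :
    IsoHom (cokernel ι) Y ≃ {π : E ⟶ Y // IsSES ι π} :=
  Equiv.ofBijective
    (fun φ => ⟨cokernel.π ι ≫ φ.1, have := φ.2; (IsSES.cokernel ι).comp_iso φ.1⟩) <| by
    refine ⟨fun φ ψ h => Subtype.ext ((cancel_epi (cokernel.π ι)).1 (Subtype.ext_iff.1 h)), ?_⟩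
    rintro ⟨π, hπ⟩
    obtain ⟨φ, hφ⟩ := (IsSES.cokernel ι).exists_iso_right hπ
    exact ⟨⟨φ.hom, inferInstance⟩, Subtype.ext hφ⟩

/-- The short exact sequences with second map `π` and subobject `X` correspond to the isomorphisms
from `kernel π` to `X`. -/
noncomputable def isSESLeftEquiv {E Y : C} (π : E ⟶ Y) [Epi π] (X : C) :
    IsoHom (kernel π) X ≃ {ι : X ⟶ E // IsSES ι π} :=
  Equiv.ofBijective
    (fun φ => ⟨have := φ.2; inv φ.1 ≫ kernel.ι π, have := φ.2; (IsSES.kernel π).iso_comp _⟩) <| by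
    constructor
    · rintro ⟨φ, hφ⟩ ⟨ψ, hψ⟩ h
      have h' := (cancel_mono (kernel.ι π)).1 (Subtype.ext_iff.1 h)
      exact Subtype.ext (IsIso.inv_eq_inv.1 h')
    · rintro ⟨ι, hι⟩
      obtain ⟨φ, hφ⟩ := (IsSES.kernel π).exists_iso_left hι
      exact ⟨⟨φ.inv, inferInstance⟩, Subtype.ext (by simpa using hφ)⟩

/-- A sum over subobjects, weighted by a function of the isomorphism class of the quotient, as a
sum over short exact sequences. -/
lemma sum_monoHom (f : IsoClass C → ℝ) (𝓕 : Finset (IsoClass C)) (hf : ∀ γ ∉ 𝓕, f γ = 0)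
    (S E : C) (G : (S ⟶ E) → ℝ) :
    ∑ ι : MonoHom S E, f ⟦cokernel ι.1⟧ * G ι.1 =
      ∑ γ ∈ 𝓕, wt γ * f γ * ∑ p : SES S E γ.obj, G p.1.1 := by
  have key (γ : IsoClass C) : ∑ p : SES S E γ.obj, G p.1.1 =
      ∑ ι : MonoHom S E, (Fintype.card (IsoHom (cokernel ι.1) γ.obj) : ℝ) * G ι.1 := by
    let e : SES S E γ.obj ≃ (Σ ι : MonoHom S E, {π : E ⟶ γ.obj // IsSES ι.1 π}) :=
      { toFun p := ⟨⟨p.1.1, p.2.mono⟩, p.1.2, p.2⟩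
        invFun s := ⟨(s.1.1, s.2.1), s.2.2⟩
        left_inv _ := rfl
        right_inv _ := rfl }
    rw [Fintype.sum_equiv e (fun p => G p.1.1) (fun s => G s.1.1) fun _ => rfl,
      Fintype.sum_sigma]
    refine Finset.sum_congr rfl fun ι _ => ?_
    have := ι.2
    rw [Fintype.card_congr (isSESRightEquiv ι.1 γ.obj)]
    simp
  simp_rw [key, Finset.mul_sum]
  rw [Finset.sum_comm]
  refine Finset.sum_congr rfl fun ι _ => ?_
  rw [← sum_wt_mul_card_isoHom (cokernel ι.1) 𝓕 f (hf _), Finset.sum_mul]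
  exact Finset.sum_congr rfl fun γ _ => by ring

/-- A sum over quotient objects, weighted by a function of the isomorphism class of the kernel,
as a sum over short exact sequences. -/
lemma sum_epiHom (f : IsoClass C → ℝ) (𝓕 : Finset (IsoClass C)) (hf : ∀ γ ∉ 𝓕, f γ = 0)
    (S E : C) (G : (E ⟶ S) → ℝ) :
    ∑ π : EpiHom E S, f ⟦kernel π.1⟧ * G π.1 =
      ∑ γ ∈ 𝓕, wt γ * f γ * ∑ p : SES γ.obj E S, G p.1.2 := by
  have key (γ : IsoClass C) : ∑ p : SES γ.obj E S, G p.1.2 =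
      ∑ π : EpiHom E S, (Fintype.card (IsoHom (kernel π.1) γ.obj) : ℝ) * G π.1 := by
    let e : SES γ.obj E S ≃ (Σ π : EpiHom E S, {ι : γ.obj ⟶ E // IsSES ι π.1}) :=
      { toFun p := ⟨⟨p.1.2, p.2.epi⟩, p.1.1, p.2⟩
        invFun s := ⟨(s.2.1, s.1.1), s.2.2⟩
        left_inv _ := rfl
        right_inv _ := rfl }
    rw [Fintype.sum_equiv e (fun p => G p.1.2) (fun s => G s.1.1) fun _ => rfl,
      Fintype.sum_sigma]
    refine Finset.sum_congr rfl fun π _ => ?_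
    have := π.2
    rw [Fintype.card_congr (isSESLeftEquiv π.1 γ.obj)]
    simp
  simp_rw [key, Finset.mul_sum]
  rw [Finset.sum_comm]
  refine Finset.sum_congr rfl fun π _ => ?_
  rw [← sum_wt_mul_card_isoHom (kernel π.1) 𝓕 f (hf _), Finset.sum_mul]
  exact Finset.sum_congr rfl fun γ _ => by ring

end WeightedSums

/-! ### Counting extensions -/

section CountingExtensions

open scoped Classical

variable {C : Type u} [Category.{v} C] [Abelian C] [HasExt.{w} C]

/-- The isomorphisms from the middle term of a fixed extension of class `e` onto `E` are counted by
the extensions of class `e` with middle term `E`, up to a factor `|Hom(Z, S)|`, the number of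
automorphisms of an extension. -/
lemma bijective_add_comp {S Z E₀ : C} {ι₀ : S ⟶ E₀} {π₀ : E₀ ⟶ Z} (h₀ : IsSES ι₀ π₀) (E : C)
    (φ : {p : SES S E Z // p.2.extClass.{w} = h₀.extClass} → (E₀ ⟶ E))
    (hφ₁ : ∀ p, ι₀ ≫ φ p = p.1.1.1) (hφ₂ : ∀ p, φ p ≫ p.1.1.2 = π₀) :
    Function.Bijective
      (fun x : {p : SES S E Z // p.2.extClass.{w} = h₀.extClass} × (Z ⟶ S) =>
        (⟨φ x.1 + π₀ ≫ x.2 ≫ x.1.1.1.1, h₀.isIso_of_comp x.1.1.2 _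
          (by rw [Preadditive.comp_add, hφ₁, ← Category.assoc, h₀.zero, zero_comp, add_zero])
          (by rw [Preadditive.add_comp, hφ₂, Category.assoc, Category.assoc, x.1.1.2.zero,
            comp_zero, comp_zero, add_zero])⟩ : IsoHom E₀ E)) := by
  have hmono := h₀.mono
  have hepi := h₀.epi
  constructor
  · rintro ⟨⟨⟨⟨ι, π⟩, h⟩, hp⟩, a⟩ ⟨⟨⟨⟨ι', π'⟩, h'⟩, hp'⟩, a'⟩ heq
    have heq := Subtype.ext_iff.1 heq
    dsimp only at heq
    have e₁ : ι = ι' := by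
      have := congrArg (fun x => ι₀ ≫ x) heq
      simp only [Preadditive.comp_add, hφ₁] at this
      simpa only [← Category.assoc, h₀.zero, zero_comp, add_zero] using this
    subst e₁
    have e₂ : π = π' := by
      have hi : IsIso (φ ⟨⟨(ι, π), h⟩, hp⟩ + π₀ ≫ a ≫ ι) := h₀.isIso_of_comp h _
          (by rw [Preadditive.comp_add, hφ₁, ← Category.assoc, h₀.zero, zero_comp, add_zero])
          (by rw [Preadditive.add_comp, hφ₂, Category.assoc, Category.assoc, h.zero,
            comp_zero, comp_zero, add_zero])
      rw [← cancel_epi (φ ⟨⟨(ι, π), h⟩, hp⟩ + π₀ ≫ a ≫ ι)]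
      conv_rhs => rw [heq]
      rw [Preadditive.add_comp, Preadditive.add_comp, hφ₂, hφ₂]
      simp [h.zero, h'.zero]
    subst e₂
    have e₃ : a = a' := by
      have hm := h.mono
      have := add_left_cancel heq
      rwa [cancel_epi, cancel_mono] at this
    subst e₃
    rfl
  · rintro ⟨ψ, hψ⟩
    have h : IsSES (ι₀ ≫ ψ) (inv ψ ≫ π₀) := h₀.middle_iso (asIso ψ)
    have hp : h.extClass.{w} = h₀.extClass := by
      have := h₀.extClass_naturality.{w} h (𝟙 S) ψ (𝟙 Z) (by simp) (by simp)
      rwa [Ext.comp_mk₀_id, Ext.mk₀_id_comp, eq_comm] at this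
    let p : {p : SES S E Z // p.2.extClass.{w} = h₀.extClass} := ⟨⟨(ι₀ ≫ ψ, inv ψ ≫ π₀), h⟩, hp⟩
    obtain ⟨s, hs⟩ := h₀.exists_desc (ψ - φ p) (by
      rw [Preadditive.comp_sub, hφ₁, sub_self])
    obtain ⟨a, ha⟩ := h.exists_lift s (by
      rw [← cancel_epi π₀, ← Category.assoc, hs, comp_zero, Preadditive.sub_comp]
      rw [show φ p ≫ inv ψ ≫ π₀ = π₀ from hφ₂ p, IsIso.hom_inv_id_assoc, sub_self])
    refine ⟨⟨p, a⟩, Subtype.ext ?_⟩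
    change φ p + π₀ ≫ a ≫ ι₀ ≫ ψ = ψ
    rw [ha, hs, add_sub_cancel]

variable [∀ X Y : C, Finite (X ⟶ Y)]

attribute [local instance] homFintype

lemma card_ses_extClass_eq_mul {S Z E₀ : C} {ι₀ : S ⟶ E₀} {π₀ : E₀ ⟶ Z} (h₀ : IsSES ι₀ π₀)
    (E : C) :
    Fintype.card {p : SES S E Z // p.2.extClass.{w} = h₀.extClass} * Fintype.card (Z ⟶ S) =
      Fintype.card (IsoHom E₀ E) := by
  have hex (p : {p : SES S E Z // p.2.extClass.{w} = h₀.extClass}) :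
      ∃ φ : E₀ ⟶ E, ι₀ ≫ φ = p.1.1.1 ∧ φ ≫ p.1.1.2 = π₀ := by
    obtain ⟨φ, h₁, h₂⟩ := h₀.exists_iso_of_extClass_eq p.1.2 p.2.symm
    exact ⟨φ.hom, h₁, by rw [← h₂, Iso.hom_inv_id_assoc]⟩
  choose φ hφ₁ hφ₂ using hex
  rw [← Fintype.card_prod]
  exact Fintype.card_of_bijective (bijective_add_comp h₀ E φ hφ₁ hφ₂)

variable [∀ X Y : C, Finite (Ext.{w} X Y 1)]

noncomputable local instance extFintype (X Y : C) : Fintype (Ext.{w} X Y 1) := Fintype.ofFinite _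

/-- Riedtmann's formula: the extensions of `Z` by `S`, counted with the weights of their middle
terms, are equidistributed over `Ext¹(Z, S)` with total mass `|Ext¹(Z, S)| / |Hom(Z, S)|`. -/
lemma sum_ses_extClass (S Z : C) (𝓔 : Finset (IsoClass C))
    (h𝓔 : ∀ (E : C) (ι : S ⟶ E) (π : E ⟶ Z), IsSES ι π → ⟦E⟧ ∈ 𝓔) (H : Ext.{w} Z S 1 → ℝ) :
    (∑ E ∈ 𝓔, wt E * ∑ p : SES S E.obj Z, H p.2.extClass) * Fintype.card (Z ⟶ S) =
      ∑ e, H e := by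
  have key (E : IsoClass C) : ∑ p : SES S E.obj Z, H p.2.extClass =
      ∑ e, H e * Fintype.card {p : SES S E.obj Z // p.2.extClass = e} := by
    rw [← Finset.sum_fiberwise (s := Finset.univ) (g := fun p : SES S E.obj Z => p.2.extClass.{w})]
    refine Finset.sum_congr rfl fun e _ => ?_
    rw [Finset.sum_congr rfl (g := fun _ => H e)
      fun p hp => by rw [(Finset.mem_filter.1 hp).2], Finset.sum_const, nsmul_eq_mul, mul_comm,
      Fintype.card_subtype]
  simp_rw [key, Finset.mul_sum]
  rw [Finset.sum_comm, Finset.sum_mul]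
  refine Finset.sum_congr rfl fun e _ => ?_
  obtain ⟨E₀, ι₀, π₀, h₀, rfl⟩ := exists_extClass_eq e
  have h1 := sum_wt_mul_card_isoHom E₀ 𝓔 (fun _ => H h₀.extClass)
    (fun h => absurd (h𝓔 E₀ ι₀ π₀ h₀) h)
  rw [Finset.sum_mul]
  refine Eq.trans ?_ h1
  refine Finset.sum_congr rfl fun E _ => ?_
  rw [← card_ses_extClass_eq_mul h₀]
  push_cast
  ring

/-- The total weight of the extensions of `Z` by `S`. -/
lemma sum_wt_mul_card_ses (S Z : C) (𝓔 : Finset (IsoClass C))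
    (h𝓔 : ∀ (E : C) (ι : S ⟶ E) (π : E ⟶ Z), IsSES ι π → ⟦E⟧ ∈ 𝓔) :
    ∑ E ∈ 𝓔, wt E * Fintype.card (SES S E.obj Z) =
      Fintype.card (Ext.{w} Z S 1) / Fintype.card (Z ⟶ S) := by
  have h := sum_ses_extClass.{w} S Z 𝓔 h𝓔 (fun _ => 1)
  have hpos : (0 : ℝ) < Fintype.card (Z ⟶ S) := Nat.cast_pos.2 (Fintype.card_pos_iff.2 ⟨0⟩)
  rw [eq_div_iff hpos.ne']
  simpa using h

omit [∀ X Y : C, Finite (X ⟶ Y)] in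
/-- Only finitely many isomorphism classes occur as extensions of `Z` by `S`. -/
lemma finite_middle_terms (S Z : C) :
    {E : IsoClass C | ∃ (ι : S ⟶ E.obj) (π : E.obj ⟶ Z), IsSES ι π}.Finite := by
  let c : {E : IsoClass C | ∃ (ι : S ⟶ E.obj) (π : E.obj ⟶ Z), IsSES ι π} → Ext.{w} Z S 1 :=
    fun E => E.2.choose_spec.choose_spec.extClass
  refine Set.finite_coe_iff.1 (Finite.of_injective c ?_)
  intro E E' h
  obtain ⟨φ, -, -⟩ := IsSES.exists_iso_of_extClass_eq _ _ h
  exact Subtype.ext ((IsoClass.mk_obj _).symm.trans (IsoClass.eq_of_iso_obj φ))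

end CountingExtensions

/-! ### Pullbacks and pushouts of extensions -/

section PullbacksOfExtensions

variable {C : Type u} [Category.{v} C] [Abelian C]

lemma IsSES.of_isPullback {E G Z A S : C} {q₁ : E ⟶ Z} {q₂ : E ⟶ G} {p : Z ⟶ A} {p₂ : G ⟶ A}
    (sq : IsPullback q₁ q₂ p p₂) {j : S ⟶ G} (h : IsSES j p₂) :
    IsSES (sq.lift 0 j (by rw [zero_comp, h.zero])) q₁ := by
  have hj := h.mono
  have hp := h.epi
  have hepi : Epi q₁ := by
    rw [← sq.isoPullback_hom_fst]
    infer_instance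
  have hmono : Mono (sq.lift 0 j (by rw [zero_comp, h.zero])) := by
    have : Mono (sq.lift 0 j (by rw [zero_comp, h.zero]) ≫ q₂) := by
      rw [sq.lift_snd]; exact hj
    exact mono_of_mono _ q₂
  refine IsSES.of_lift (sq.lift_fst _ _ _) fun t ht => ?_
  obtain ⟨s, hs⟩ := h.exists_lift (t ≫ q₂) (by
    rw [Category.assoc, ← sq.w, ← Category.assoc, ht, zero_comp])
  refine ⟨s, sq.hom_ext ?_ ?_⟩
  · rw [Category.assoc, sq.lift_fst, comp_zero, ht]
  · rw [Category.assoc, sq.lift_snd, hs]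

lemma IsSES.of_isPushout {E G Z K S : C} {i : K ⟶ Z} {i₂ : K ⟶ G} {k₁ : Z ⟶ E} {k₂ : G ⟶ E}
    (sq : IsPushout i i₂ k₁ k₂) {q : G ⟶ S} (h : IsSES i₂ q) :
    IsSES k₁ (sq.desc 0 q (by rw [comp_zero, h.zero])) := by
  have hj := h.mono
  have hp := h.epi
  have hmono : Mono k₁ := by
    rw [← sq.inl_isoPushout_inv]
    infer_instance
  have hepi : Epi (sq.desc 0 q (by rw [comp_zero, h.zero])) := by
    have : Epi (k₂ ≫ sq.desc 0 q (by rw [comp_zero, h.zero])) := by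
      rw [sq.inr_desc]; exact hp
    exact epi_of_epi k₂ _
  refine IsSES.of_desc (sq.inl_desc _ _ _) fun t ht => ?_
  obtain ⟨s, hs⟩ := h.exists_desc (k₂ ≫ t) (by
    rw [← Category.assoc, ← sq.w, Category.assoc, ht, comp_zero])
  refine ⟨s, sq.hom_ext ?_ ?_⟩
  · rw [← Category.assoc, sq.inl_desc, zero_comp, ht]
  · rw [← Category.assoc, sq.inr_desc, hs]

/-- If a subobject `ι₂` of `E` meets the kernel of `π : E ⟶ Z` trivially, then `E` is the
fibre product of `Z` and the quotient by `ι₂`. -/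
lemma isPullback_of_isSES {E G Z A S : C} {π : E ⟶ Z} {ι₂ : S ⟶ E} {π₂ : E ⟶ G} {p : Z ⟶ A}
    {p₂ : G ⟶ A} (h₂ : IsSES ι₂ π₂) (hp : IsSES (ι₂ ≫ π) p)
    (w : π ≫ p = π₂ ≫ p₂) : IsPullback π π₂ p p₂ := by
  -- The comparison map to the fibre product is a morphism of extensions of `G` by `S`.
  have sq := IsPullback.of_hasPullback p p₂
  have hc₁ : sq.lift π π₂ w ≫ pullback.fst p p₂ = π := sq.lift_fst _ _ _
  have hc₂ : sq.lift π π₂ w ≫ pullback.snd p p₂ = π₂ := sq.lift_snd _ _ _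
  have hc : IsIso (sq.lift π π₂ w) := h₂.isIso_of_comp (IsSES.of_isPullback sq.flip hp) _
    (sq.flip.hom_ext
      (by rw [Category.assoc, hc₂, h₂.zero, sq.flip.lift_fst])
      (by rw [Category.assoc, hc₁, sq.flip.lift_snd])) hc₂
  exact IsPullback.of_iso_pullback ⟨w⟩ (asIso (sq.lift π π₂ w)) hc₁ hc₂

lemma isPushout_of_isSES {E G Z K S : C} {κ : Z ⟶ E} {π₂ : E ⟶ S} {κ₂ : G ⟶ E} {i : K ⟶ Z}
    {i₂ : K ⟶ G} (h₂ : IsSES κ₂ π₂) (hi : IsSES i (κ ≫ π₂))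
    (w : i ≫ κ = i₂ ≫ κ₂) : IsPushout i i₂ κ κ₂ := by
  have sq := IsPushout.of_hasPushout i i₂
  have hc₁ : pushout.inl i i₂ ≫ sq.desc κ κ₂ w = κ := sq.inl_desc _ _ _
  have hc₂ : pushout.inr i i₂ ≫ sq.desc κ κ₂ w = κ₂ := sq.inr_desc _ _ _
  have hc : IsIso (sq.desc κ κ₂ w) := (IsSES.of_isPushout sq.flip hi).isIso_of_comp h₂ _ hc₂
    (sq.flip.hom_ext
      (by rw [← Category.assoc, hc₂, h₂.zero, sq.flip.inl_desc])
      (by rw [← Category.assoc, hc₁, sq.flip.inr_desc]))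
  exact IsPushout.of_iso_pushout ⟨w⟩ (asIso (sq.desc κ κ₂ w)).symm
    (by rw [Iso.symm_hom, asIso_inv, IsIso.comp_inv_eq, hc₁])
    (by rw [Iso.symm_hom, asIso_inv, IsIso.comp_inv_eq, hc₂])

end PullbacksOfExtensions

section

open scoped Classical

variable {C : Type u} [Category.{v} C] [Abelian C] [HasExt.{w} C]
variable [∀ X Y : C, Finite (X ⟶ Y)] [∀ X Y : C, Finite (Ext.{w} X Y 1)]

attribute [local instance] homFintype extFintype

lemma sum_comp_eq_zero_of_surjective {G H : Type*} [AddGroup G] [AddGroup H] [Fintype G]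
    [Fintype H] (g : G →+ H) (hg : Function.Surjective g) (φ : H → ℝ) (hφ : ∑ x, φ x = 0) :
    ∑ x, φ (g x) = 0 := by
  rw [← Finset.sum_fiberwise (s := Finset.univ) (g := g)]
  have (y : H) : ∑ x with g x = y, φ (g x) = (Finset.univ.filter fun x => g x = 0).card * φ y := by
    rw [Finset.sum_congr rfl (g := fun _ => φ y) fun x hx => by rw [(Finset.mem_filter.1 hx).2],
      Finset.sum_const, nsmul_eq_mul]
    congr 2
    exact AddMonoidHom.card_fiber_eq_of_mem_range g (hg y) (hg 0)
  simp_rw [this, ← Finset.mul_sum, hφ, mul_zero]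

/-- The function on `Ext¹(A, S)` induced by a function `f` of the middle term of an extension; the
choice of a realization is immaterial by `middleFun_extClass`. -/
noncomputable def middleFun (f : IsoClass C → ℝ) (S A : C) (e : Ext.{w} A S 1) : ℝ :=
  f ⟦(exists_extClass_eq e).choose⟧

omit [∀ X Y : C, Finite (X ⟶ Y)] [∀ X Y : C, Finite (Ext.{w} X Y 1)] in
lemma middleFun_extClass (f : IsoClass C → ℝ) {S A X : C} {j : S ⟶ X} {p : X ⟶ A}
    (h : IsSES j p) : middleFun f S A h.extClass.{w} = f ⟦X⟧ := by
  obtain ⟨φ, -, -⟩ := IsSES.exists_iso_of_extClass_eq _ h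
    (exists_extClass_eq h.extClass.{w}).choose_spec.choose_spec.choose_spec.choose_spec
  rw [middleFun, IsoClass.mk_eq_of_iso φ]

lemma sum_middleFun_eq_zero (f : IsoClass C → ℝ) (𝓕 : Finset (IsoClass C))
    (hf : ∀ γ ∉ 𝓕, f γ = 0) (S A : C)
    (h : ∑ γ ∈ 𝓕, wt γ * f γ * Fintype.card (SES S γ.obj A) = 0) :
    ∑ e, middleFun.{w} f S A e = 0 := by
  let 𝓔 := (finite_middle_terms.{w} S A).toFinset ∪ 𝓕
  rw [← sum_ses_extClass S A 𝓔]
  · simp_rw [middleFun_extClass]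
    rw [← Finset.sum_subset (s₁ := 𝓕) Finset.subset_union_right]
    · convert zero_mul _
      rw [← h]
      refine Finset.sum_congr rfl fun γ _ => ?_
      rw [Finset.sum_const, nsmul_eq_mul, Finset.card_univ, IsoClass.mk_obj]
      ring
    · intro γ _ hγ
      simp [IsoClass.mk_obj, hf γ hγ]
  · intro E ι π hE
    obtain ⟨e⟩ := IsoClass.nonempty_iso_obj E
    refine Finset.mem_union_left _ ((Set.Finite.mem_toFinset _).2 ?_)
    exact ⟨_, _, hE.middle_iso e⟩

/-- Extensions of `Z` by `S`, weighted by the middle term of their restriction to the kernel of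
an epimorphism `Z ⟶ S`: every extension of the kernel lifts to `Z`, and the number of lifts is
constant, because `Ext²(S, S) = 0`. -/
lemma sum_ses_kernel_comp_eq_zero (S Z : C) (hS : Subsingleton (Ext.{w} S S 2))
    (f : IsoClass C → ℝ) (𝓕 : Finset (IsoClass C)) (hf : ∀ γ ∉ 𝓕, f γ = 0)
    (h : ∀ A : C, ∑ γ ∈ 𝓕, wt γ * f γ * Fintype.card (SES S γ.obj A) = 0)
    (𝓔 : Finset (IsoClass C))
    (h𝓔 : ∀ (E : C) (ι : S ⟶ E) (π : E ⟶ Z), IsSES ι π → ⟦E⟧ ∈ 𝓔) (q : Z ⟶ S) [Epi q] :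
    ∑ E ∈ 𝓔, wt E * ∑ p : SES S E.obj Z, f ⟦kernel (p.1.2 ≫ q)⟧ = 0 := by
  have hker := IsSES.kernel q
  let g : Ext.{w} Z S 1 →+ Ext.{w} (kernel q) S 1 :=
    (Ext.mk₀ (kernel.ι q)).precomp S (zero_add 1)
  have hg : Function.Surjective g := fun x =>
    Ext.contravariant_sequence_exact₁ hker.2 S x (n₁ := 2) rfl (Subsingleton.elim _ _)
  have hval (E : C) (p : SES S E Z) :
      f ⟦kernel (p.1.2 ≫ q)⟧ = middleFun f S (kernel q) (g p.2.extClass) := by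
    obtain ⟨⟨ι, π⟩, hp⟩ := p
    have sq : IsPullback (kernel.lift q (kernel.ι (π ≫ q) ≫ π) (by simp)) (kernel.ι (π ≫ q))
        (kernel.ι q) π := by
      refine ⟨⟨by simp⟩, ⟨PullbackCone.IsLimit.mk _
        (fun s => kernel.lift _ s.snd (by
          rw [← Category.assoc, ← s.condition, Category.assoc, kernel.condition, comp_zero]))
        (fun s => ?_) (fun s => by simp) (fun s m _ hm => ?_)⟩⟩
      · rw [← cancel_mono (kernel.ι q)]
        simp [s.condition]
      · rw [← cancel_mono (kernel.ι (π ≫ q)), hm]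
        simp
    have hX := IsSES.of_isPullback sq hp
    have hnat := hX.extClass_naturality.{w} hp (𝟙 S) (kernel.ι (π ≫ q)) (kernel.ι q)
      (by simp) sq.w.symm
    rw [Ext.comp_mk₀_id] at hnat
    change _ = middleFun f S (kernel q) ((Ext.mk₀ (kernel.ι q)).comp hp.extClass (zero_add 1))
    rw [← hnat, middleFun_extClass]
  simp_rw [hval]
  have hpos : (0 : ℝ) < Fintype.card (Z ⟶ S) := Nat.cast_pos.2 (Fintype.card_pos_iff.2 ⟨0⟩)
  have hsum := sum_ses_extClass.{w} S Z 𝓔 h𝓔 (fun e => middleFun f S (kernel q) (g e))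
  rw [sum_comp_eq_zero_of_surjective g hg _
    (sum_middleFun_eq_zero f 𝓕 hf S (kernel q) (h (kernel q)))] at hsum
  exact (mul_eq_zero.1 hsum).resolve_right hpos.ne'

end

/-! ### Sums over pairs of simple subobjects or quotients -/

section FibreProducts

open scoped Classical

variable {C : Type u} [Category.{v} C] [Abelian C]

/-- The ways to make `E` a fibre product of `p` and `p₂` correspond to the isomorphisms from
`pullback p p₂` to `E`. -/
noncomputable def isPullbackEquiv {Z G A : C} (p : Z ⟶ A) (p₂ : G ⟶ A) (E : C) :
    IsoHom (pullback p p₂) E ≃ {q : (E ⟶ Z) × (E ⟶ G) // IsPullback q.1 q.2 p p₂} :=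
  Equiv.ofBijective
    (fun φ => ⟨have := φ.2; (inv φ.1 ≫ pullback.fst p p₂, inv φ.1 ≫ pullback.snd p p₂),
      have := φ.2
      IsPullback.of_iso_pullback ⟨by simp [pullback.condition]⟩ (asIso φ.1).symm
        (by simp) (by simp)⟩) <| by
    constructor
    · rintro ⟨φ, hφ⟩ ⟨ψ, hψ⟩ h
      have h := Prod.ext_iff.1 (Subtype.ext_iff.1 h)
      exact Subtype.ext (IsIso.inv_eq_inv.1 (pullback.hom_ext h.1 h.2))
    · rintro ⟨⟨q₁, q₂⟩, hq⟩
      exact ⟨⟨hq.isoPullback.inv, inferInstance⟩, Subtype.ext (Prod.ext (by simp) (by simp))⟩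

/-- The ways to make `E` an amalgamated sum of `i` and `i₂` correspond to the isomorphisms from
`pushout i i₂` to `E`. -/
noncomputable def isPushoutEquiv {Z G K : C} (i : K ⟶ Z) (i₂ : K ⟶ G) (E : C) :
    IsoHom (pushout i i₂) E ≃ {q : (Z ⟶ E) × (G ⟶ E) // IsPushout i i₂ q.1 q.2} :=
  Equiv.ofBijective
    (fun φ => ⟨(pushout.inl i i₂ ≫ φ.1, pushout.inr i i₂ ≫ φ.1),
      have := φ.2
      IsPushout.of_iso_pushout ⟨by simp [pushout.condition_assoc]⟩ (asIso φ.1).symm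
        (by simp) (by simp)⟩) <| by
    constructor
    · rintro ⟨φ, hφ⟩ ⟨ψ, hψ⟩ h
      have h := Prod.ext_iff.1 (Subtype.ext_iff.1 h)
      exact Subtype.ext (pushout.hom_ext h.1 h.2)
    · rintro ⟨⟨q₁, q₂⟩, hq⟩
      exact ⟨⟨hq.isoPushout.inv, inferInstance⟩, Subtype.ext (Prod.ext (by simp) (by simp))⟩

/-- An extension `E` of `Z` by `S` together with a lift `ι₂ : S ⟶ E` of `j : S ⟶ Z` with quotient `G`
is the fibre product of `Z` and `G`, where `G` is an extension of `A = Z / j(S)` by `S`. -/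
noncomputable def liftEquiv {S Z A : C} (j : S ⟶ Z) (c : Z ⟶ A) (hjc : IsSES j c) (E G : C) :
    (Σ x : SES S E G, {p : SES S E Z // x.1.1 ≫ p.1.2 = j}) ≃
      Σ y : SES S G A, {q : (E ⟶ Z) × (E ⟶ G) // IsPullback q.1 q.2 c y.1.2} :=
  Equiv.ofBijective
    (fun s =>
      have hw : s.1.1.1 ≫ s.2.1.1.2 ≫ c = 0 := by
        rw [← Category.assoc, s.2.2, hjc.zero]
      have hy := (s.1.2.exists_desc _ hw).choose_spec
      have sq : IsPullback s.2.1.1.2 s.1.1.2 c (s.1.2.exists_desc _ hw).choose :=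
        isPullback_of_isSES s.1.2 (by rw [s.2.2]; exact hjc) hy.symm
      have hj : IsSES (s.2.1.1.1 ≫ s.1.1.2) (s.1.2.exists_desc _ hw).choose := by
        have := s.2.1.2.mono
        have hm : Mono (s.2.1.1.1 ≫ s.1.1.2) := Preadditive.mono_of_cancel_zero _ fun t ht => by
          rw [← cancel_mono s.2.1.1.1, zero_comp]
          refine sq.hom_ext ?_ ?_
          · rw [Category.assoc, s.2.1.2.zero, comp_zero, zero_comp]
          · rw [Category.assoc, ht, zero_comp]
        have he : Epi (s.1.2.exists_desc _ hw).choose := by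
          have h1 := s.2.1.2.epi
          have h2 := hjc.epi
          have h3 : Epi (s.1.1.2 ≫ (s.1.2.exists_desc _ hw).choose) := by
            rw [hy]; exact epi_comp _ _
          exact epi_of_epi s.1.1.2 _
        refine IsSES.of_lift (by rw [Category.assoc, hy, ← Category.assoc, s.2.1.2.zero,
          zero_comp]) fun t ht => ?_
        obtain ⟨r, hr⟩ := s.2.1.2.exists_lift (sq.lift 0 t (by rw [zero_comp, ht])) (by
          rw [sq.lift_fst])
        exact ⟨r, by rw [← Category.assoc, hr, sq.lift_snd]⟩
      (⟨⟨(s.2.1.1.1 ≫ s.1.1.2, (s.1.2.exists_desc _ hw).choose), hj⟩,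
        ⟨(s.2.1.1.2, s.1.1.2), sq⟩⟩ :
        Σ y : SES S G A, {q : (E ⟶ Z) × (E ⟶ G) // IsPullback q.1 q.2 c y.1.2})) <| by
    have inj : ∀ (y y' : Σ y : SES S G A,
        {q : (E ⟶ Z) × (E ⟶ G) // IsPullback q.1 q.2 c y.1.2}),
        y = y' ↔ y.1 = y'.1 ∧ y.2.1 = y'.2.1 := by
      rintro ⟨y, q, hq⟩ ⟨y', q', hq'⟩
      constructor
      · intro h; cases h; exact ⟨rfl, rfl⟩
      · rintro ⟨h, h'⟩
        dsimp only at h h'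
        subst h; subst h'; rfl
    constructor
    · rintro ⟨⟨⟨ι₂, π₂⟩, h₂⟩, ⟨⟨⟨ι, π⟩, h⟩, hj⟩⟩ ⟨⟨⟨ι₂', π₂'⟩, h₂'⟩, ⟨⟨⟨ι', π'⟩, h'⟩, hj'⟩⟩ heq
      obtain ⟨e1, e2⟩ := (inj _ _).1 heq
      dsimp only at e1 e2 hj hj' h h' h₂ h₂'
      obtain ⟨rfl, rfl⟩ := Prod.ext_iff.1 e2
      have e1 := (Prod.ext_iff.1 (Subtype.ext_iff.1 e1)).1
      dsimp only at e1 hj hj' h h' h₂ h₂'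
      -- Both projections from `E` are known, and they are jointly monic.
      have hw : ι₂ ≫ π ≫ c = 0 := by rw [← Category.assoc, hj, hjc.zero]
      have sq : IsPullback π π₂ c (h₂.exists_desc _ hw).choose :=
        isPullback_of_isSES h₂ (by rw [hj]; exact hjc) (h₂.exists_desc _ hw).choose_spec.symm
      have e3 : ι = ι' := sq.hom_ext (by rw [h.zero, h'.zero]) e1
      have e4 : ι₂ = ι₂' := sq.hom_ext (by rw [hj, hj']) (by rw [h₂.zero, h₂'.zero])
      subst e3; subst e4; rfl
    · rintro ⟨⟨⟨j₂, p₂⟩, hy⟩, ⟨⟨π, π₂⟩, sq⟩⟩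
      dsimp only at sq hy
      have h : IsSES _ π := IsSES.of_isPullback sq hy
      have h₂ : IsSES _ π₂ := IsSES.of_isPullback sq.flip hjc
      refine ⟨⟨⟨(_, π₂), h₂⟩, ⟨⟨(_, π), h⟩, sq.flip.lift_snd _ _ _⟩⟩, (inj _ _).2 ⟨?_, rfl⟩⟩
      refine Subtype.ext (Prod.ext (sq.lift_snd _ _ _) ?_)
      have := h₂.epi
      rw [← cancel_epi π₂, ← sq.w]
      exact (h₂.exists_desc (π ≫ c)
        (by rw [← Category.assoc, sq.flip.lift_snd, hjc.zero])).choose_spec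

/-- An extension `E` of `S` by `Z` together with `π₂ : E ⟶ S` restricting to `j : Z ⟶ S` and with
kernel `G` is the amalgamated sum of `Z` and `G`, where `G` is an extension of `S` by the kernel `K`
of `j`. -/
noncomputable def descEquiv {S Z K : C} (j : Z ⟶ S) (i : K ⟶ Z) (hij : IsSES i j) (E G : C) :
    (Σ x : SES G E S, {p : SES Z E S // p.1.1 ≫ x.1.2 = j}) ≃
      Σ y : SES K G S, {q : (Z ⟶ E) × (G ⟶ E) // IsPushout i y.1.1 q.1 q.2} :=
  Equiv.ofBijective
    (fun s =>
      have hw : (i ≫ s.2.1.1.1) ≫ s.1.1.2 = 0 := by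
        rw [Category.assoc, s.2.2, hij.zero]
      have hy := (s.1.2.exists_lift _ hw).choose_spec
      have sq : IsPushout i (s.1.2.exists_lift _ hw).choose s.2.1.1.1 s.1.1.1 :=
        isPushout_of_isSES s.1.2 (by rw [s.2.2]; exact hij) hy.symm
      have hj : IsSES (s.1.2.exists_lift _ hw).choose (s.1.1.1 ≫ s.2.1.1.2) := by
        have := s.2.1.2.epi
        have he : Epi (s.1.1.1 ≫ s.2.1.1.2) := Preadditive.epi_of_cancel_zero _ fun t ht => by
          rw [← cancel_epi s.2.1.1.2, comp_zero]
          refine sq.hom_ext ?_ ?_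
          · rw [← Category.assoc, s.2.1.2.zero, comp_zero, zero_comp]
          · rw [← Category.assoc, ht, comp_zero]
        have hm : Mono (s.1.2.exists_lift _ hw).choose := by
          have h1 := s.2.1.2.mono
          have h2 := hij.mono
          have h3 : Mono ((s.1.2.exists_lift _ hw).choose ≫ s.1.1.1) := by
            rw [hy]; exact mono_comp _ _
          exact mono_of_mono _ s.1.1.1
        refine IsSES.of_desc (by rw [← Category.assoc, hy, Category.assoc, s.2.1.2.zero,
          comp_zero]) fun t ht => ?_
        obtain ⟨r, hr⟩ := s.2.1.2.exists_desc (sq.desc 0 t (by rw [comp_zero, ht])) (by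
          rw [sq.inl_desc])
        exact ⟨r, by rw [Category.assoc, hr, sq.inr_desc]⟩
      (⟨⟨((s.1.2.exists_lift _ hw).choose, s.1.1.1 ≫ s.2.1.1.2), hj⟩,
        ⟨(s.2.1.1.1, s.1.1.1), sq⟩⟩ :
        Σ y : SES K G S, {q : (Z ⟶ E) × (G ⟶ E) // IsPushout i y.1.1 q.1 q.2})) <| by
    have inj : ∀ (y y' : Σ y : SES K G S,
        {q : (Z ⟶ E) × (G ⟶ E) // IsPushout i y.1.1 q.1 q.2}),
        y = y' ↔ y.1 = y'.1 ∧ y.2.1 = y'.2.1 := by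
      rintro ⟨y, q, hq⟩ ⟨y', q', hq'⟩
      constructor
      · intro h; cases h; exact ⟨rfl, rfl⟩
      · rintro ⟨h, h'⟩
        dsimp only at h h'
        subst h; subst h'; rfl
    constructor
    · rintro ⟨⟨⟨κ₂, π₂⟩, h₂⟩, ⟨⟨⟨κ, π⟩, h⟩, hj⟩⟩ ⟨⟨⟨κ₂', π₂'⟩, h₂'⟩, ⟨⟨⟨κ', π'⟩, h'⟩, hj'⟩⟩ heq
      obtain ⟨e1, e2⟩ := (inj _ _).1 heq
      dsimp only at e1 e2 hj hj' h h' h₂ h₂'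
      obtain ⟨rfl, rfl⟩ := Prod.ext_iff.1 e2
      have e1 := (Prod.ext_iff.1 (Subtype.ext_iff.1 e1)).2
      dsimp only at e1 hj hj' h h' h₂ h₂'
      -- Both injections into `E` are known, and they are jointly epic.
      have hw : (i ≫ κ) ≫ π₂ = 0 := by rw [Category.assoc, hj, hij.zero]
      have sq : IsPushout i (h₂.exists_lift _ hw).choose κ κ₂ :=
        isPushout_of_isSES h₂ (by rw [hj]; exact hij) (h₂.exists_lift _ hw).choose_spec.symm
      have e3 : π = π' := sq.hom_ext (by rw [h.zero, h'.zero]) e1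
      have e4 : π₂ = π₂' := sq.hom_ext (by rw [hj, hj']) (by rw [h₂.zero, h₂'.zero])
      subst e3; subst e4; rfl
    · rintro ⟨⟨⟨i₂, q₂⟩, hy⟩, ⟨⟨κ, κ₂⟩, sq⟩⟩
      dsimp only at sq hy
      have h : IsSES κ _ := IsSES.of_isPushout sq hy
      have h₂ : IsSES κ₂ _ := IsSES.of_isPushout sq.flip hij
      refine ⟨⟨⟨(κ₂, _), h₂⟩, ⟨⟨(κ, _), h⟩, sq.flip.inr_desc _ _ _⟩⟩, (inj _ _).2 ⟨?_, rfl⟩⟩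
      refine Subtype.ext (Prod.ext ?_ (sq.inr_desc _ _ _))
      have := h₂.mono
      rw [← cancel_mono κ₂, ← sq.w]
      exact (h₂.exists_lift (i ≫ κ)
        (by rw [Category.assoc, sq.flip.inr_desc, hij.zero])).choose_spec

end FibreProducts

/-! ### The three inner products -/

section InnerProducts

open scoped Classical

variable {C : Type u} [Category.{v} C] [Abelian C] [∀ X Y : C, Finite (X ⟶ Y)]

attribute [local instance] homFintype

/-- The number of pairs of extensions, of `Z` by `S` and of `G` by `S`, with the same middle term and
with `S ⟶ E ⟶ Z` equal to a fixed monomorphism `j`, weighted by the middle term. -/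
lemma sum_card_lifts {S Z A : C} (j : S ⟶ Z) (c : Z ⟶ A) (hjc : IsSES j c) (G : C)
    (𝓔 : Finset (IsoClass C))
    (h𝓔 : ∀ (E : C) (ι : S ⟶ E) (π : E ⟶ Z), IsSES ι π → ⟦E⟧ ∈ 𝓔) :
    ∑ E ∈ 𝓔, wt E * ∑ x : SES S E.obj G,
      (Fintype.card {p : SES S E.obj Z // x.1.1 ≫ p.1.2 = j} : ℝ) =
      Fintype.card (SES S G A) := by
  have key (E : C) : ∑ x : SES S E G, (Fintype.card {p : SES S E Z // x.1.1 ≫ p.1.2 = j} : ℝ) =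
      ∑ y : SES S G A, (Fintype.card (IsoHom (pullback c y.1.2) E) : ℝ) := by
    rw [← Nat.cast_sum, ← Nat.cast_sum, ← Fintype.card_sigma,
      Fintype.card_congr (liftEquiv j c hjc E G), Fintype.card_sigma]
    congr 1
    exact Finset.sum_congr rfl fun y _ => (Fintype.card_congr (isPullbackEquiv _ _ E)).symm
  simp_rw [key, Finset.mul_sum]
  rw [Finset.sum_comm, ← nsmul_one, ← Finset.card_univ, ← Finset.sum_const]
  refine Finset.sum_congr rfl fun y _ => ?_
  have := sum_wt_mul_card_isoHom (pullback c y.1.2) 𝓔 (fun _ => 1)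
    (fun h => absurd (h𝓔 _ _ _ (IsSES.of_isPullback (IsPullback.of_hasPullback c y.1.2) y.2)) h)
  simpa using this

lemma sum_card_descs {S Z K : C} (j : Z ⟶ S) (i : K ⟶ Z) (hij : IsSES i j) (G : C)
    (𝓔 : Finset (IsoClass C))
    (h𝓔 : ∀ (E : C) (κ : Z ⟶ E) (π : E ⟶ S), IsSES κ π → ⟦E⟧ ∈ 𝓔) :
    ∑ E ∈ 𝓔, wt E * ∑ x : SES G E.obj S,
      (Fintype.card {p : SES Z E.obj S // p.1.1 ≫ x.1.2 = j} : ℝ) =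
      Fintype.card (SES K G S) := by
  have key (E : C) : ∑ x : SES G E S, (Fintype.card {p : SES Z E S // p.1.1 ≫ x.1.2 = j} : ℝ) =
      ∑ y : SES K G S, (Fintype.card (IsoHom (pushout i y.1.1) E) : ℝ) := by
    rw [← Nat.cast_sum, ← Nat.cast_sum, ← Fintype.card_sigma,
      Fintype.card_congr (descEquiv j i hij E G), Fintype.card_sigma]
    congr 1
    exact Finset.sum_congr rfl fun y _ => (Fintype.card_congr (isPushoutEquiv _ _ E)).symm
  simp_rw [key, Finset.mul_sum]
  rw [Finset.sum_comm, ← nsmul_one, ← Finset.card_univ, ← Finset.sum_const]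
  refine Finset.sum_congr rfl fun y _ => ?_
  have := sum_wt_mul_card_isoHom (pushout i y.1.1) 𝓔 (fun _ => 1)
    (fun h => absurd (h𝓔 _ _ _ (IsSES.of_isPushout (IsPushout.of_hasPushout i y.1.1) y.2)) h)
  simpa using this

variable (S : C) (f : IsoClass C → ℝ) (𝓕 : Finset (IsoClass C)) (hf : ∀ γ ∉ 𝓕, f γ = 0)

/-- The sum of `f` over the quotients of `E` by the images of the monomorphisms from `S`: up to a
scalar, the coefficient at `E` of the Hall product of `f` and the class of `S`. -/
noncomputable def quotSum (E : C) : ℝ := ∑ ι : MonoHom S E, f ⟦cokernel ι.1⟧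

/-- The sum of `f` over the kernels of the epimorphisms from `E` to `S`: up to a scalar, the
coefficient at `E` of the Hall product of the class of `S` and `f`. -/
noncomputable def subSum (E : C) : ℝ := ∑ π : EpiHom E S, f ⟦kernel π.1⟧

include hf

lemma sum_quotSum_mul (𝓔 : Finset (IsoClass C)) (G : C → ℝ) :
    ∑ E ∈ 𝓔, wt E * (quotSum S f E.obj * G E.obj) =
      ∑ γ ∈ 𝓕, wt γ * f γ * ∑ E ∈ 𝓔, wt E * (Fintype.card (SES S E.obj γ.obj) * G E.obj) := by
  have key (E : IsoClass C) : quotSum S f E.obj * G E.obj =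
      ∑ γ ∈ 𝓕, wt γ * f γ * (Fintype.card (SES S E.obj γ.obj) * G E.obj) := by
    rw [quotSum, Finset.sum_mul, sum_monoHom f 𝓕 hf S E.obj (fun _ => G E.obj)]
    simp
  simp_rw [key, Finset.mul_sum]
  rw [Finset.sum_comm]
  exact Finset.sum_congr rfl fun γ _ => Finset.sum_congr rfl fun E _ => by ring

lemma sum_subSum_mul (𝓔 : Finset (IsoClass C)) (G : C → ℝ) :
    ∑ E ∈ 𝓔, wt E * (subSum S f E.obj * G E.obj) =
      ∑ γ ∈ 𝓕, wt γ * f γ * ∑ E ∈ 𝓔, wt E * (Fintype.card (SES γ.obj E.obj S) * G E.obj) := by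
  have key (E : IsoClass C) : subSum S f E.obj * G E.obj =
      ∑ γ ∈ 𝓕, wt γ * f γ * (Fintype.card (SES γ.obj E.obj S) * G E.obj) := by
    rw [subSum, Finset.sum_mul, sum_epiHom f 𝓕 hf S E.obj (fun _ => G E.obj)]
    simp
  simp_rw [key, Finset.mul_sum]
  rw [Finset.sum_comm]
  exact Finset.sum_congr rfl fun γ _ => Finset.sum_congr rfl fun E _ => by ring

/-- Extensions of `Z` by `S` with a second copy of `S` lying over a fixed monomorphism
`j : S ⟶ Z` contribute nothing: they are extensions by `S` of an extension of `Z / j(S)` by `S`, and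
`f` is orthogonal to the product of the classes of `Z / j(S)` and `S`. -/
lemma sum_lifts_eq_zero {Z : C} (j : S ⟶ Z) [Mono j]
    (h : ∀ A : C, ∑ γ ∈ 𝓕, wt γ * f γ * Fintype.card (SES S γ.obj A) = 0)
    (𝓔 : Finset (IsoClass C))
    (h𝓔 : ∀ (E : C) (ι : S ⟶ E) (π : E ⟶ Z), IsSES ι π → ⟦E⟧ ∈ 𝓔) :
    ∑ E ∈ 𝓔, wt E * ∑ ι₂ : MonoHom S E.obj, f ⟦cokernel ι₂.1⟧ *
      Fintype.card {p : SES S E.obj Z // ι₂.1 ≫ p.1.2 = j} = 0 := by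
  rw [← h (cokernel j)]
  simp_rw [sum_monoHom f 𝓕 hf S _
    (fun ι₂ => (Fintype.card {p : SES S _ Z // ι₂ ≫ p.1.2 = j} : ℝ)), Finset.mul_sum (s := 𝓕)]
  rw [Finset.sum_comm]
  refine Finset.sum_congr rfl fun γ _ => ?_
  rw [← sum_card_lifts j (cokernel.π j) (IsSES.cokernel j) γ.obj 𝓔 h𝓔, Finset.mul_sum]
  exact Finset.sum_congr rfl fun E _ => by ring

lemma sum_descs_eq_zero {Z : C} (j : Z ⟶ S) [Epi j]
    (h : ∀ A : C, ∑ γ ∈ 𝓕, wt γ * f γ * Fintype.card (SES A γ.obj S) = 0)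
    (𝓔 : Finset (IsoClass C))
    (h𝓔 : ∀ (E : C) (κ : Z ⟶ E) (π : E ⟶ S), IsSES κ π → ⟦E⟧ ∈ 𝓔) :
    ∑ E ∈ 𝓔, wt E * ∑ π₂ : EpiHom E.obj S, f ⟦kernel π₂.1⟧ *
      Fintype.card {p : SES Z E.obj S // p.1.1 ≫ π₂.1 = j} = 0 := by
  rw [← h (kernel j)]
  simp_rw [sum_epiHom f 𝓕 hf S _
    (fun π₂ => (Fintype.card {p : SES Z _ S // p.1.1 ≫ π₂ = j} : ℝ)), Finset.mul_sum (s := 𝓕)]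
  rw [Finset.sum_comm]
  refine Finset.sum_congr rfl fun γ _ => ?_
  rw [← sum_card_descs j (kernel.ι j) (IsSES.kernel j) γ.obj 𝓔 h𝓔, Finset.mul_sum]
  exact Finset.sum_congr rfl fun E _ => by ring

omit hf in
/-- If the second copy `ι₂` of a simple `S` is killed by `E ⟶ Z`, it has the same image as the first,
so the two differ by an automorphism of `S` and the quotient by `ι₂` is `Z`. -/
lemma sum_lifts_zero [Simple S] (Z E : C) :
    ∑ ι₂ : MonoHom S E, f ⟦cokernel ι₂.1⟧ *
      Fintype.card {p : SES S E Z // ι₂.1 ≫ p.1.2 = 0} =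
      Fintype.card (IsoHom S S) * f ⟦Z⟧ * Fintype.card (SES S E Z) := by
  have hval (ι₂ : MonoHom S E) : f ⟦cokernel ι₂.1⟧ *
      Fintype.card {p : SES S E Z // ι₂.1 ≫ p.1.2 = 0} =
      Fintype.card {p : SES S E Z // ι₂.1 ≫ p.1.2 = 0} * f ⟦Z⟧ := by
    obtain h | ⟨⟨⟨⟨ι, π⟩, h⟩, h0⟩⟩ := isEmpty_or_nonempty {p : SES S E Z // ι₂.1 ≫ p.1.2 = 0}
    · simp
    · obtain ⟨σ, hσ⟩ := h.exists_lift ι₂.1 h0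
      have hm := ι₂.2
      have hm' : Mono σ := by
        have : Mono (σ ≫ ι) := by rw [hσ]; exact hm
        exact mono_of_mono σ ι
      have hi : IsIso σ := isIso_of_mono_of_nonzero fun h0 =>
        id_nonzero S ((cancel_mono σ).1 (by rw [h0, comp_zero, comp_zero]))
      have h2 : IsSES ι₂.1 π := hσ ▸ h.iso_comp σ
      obtain ⟨φ, -⟩ := (IsSES.cokernel ι₂.1).exists_iso_right h2
      rw [IsoClass.mk_eq_of_iso φ, mul_comm]
  simp_rw [hval]
  rw [← Finset.sum_mul, ← Nat.cast_sum, ← Fintype.card_sigma]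
  let e : IsoHom S S × SES S E Z →
      Σ ι₂ : MonoHom S E, {p : SES S E Z // ι₂.1 ≫ p.1.2 = 0} := fun x =>
    ⟨⟨x.1.1 ≫ x.2.1.1, have := x.1.2; have := x.2.2.mono; mono_comp _ _⟩,
      x.2, by rw [Category.assoc, x.2.2.zero, comp_zero]⟩
  have he : Function.Bijective e := by
    constructor
    · rintro ⟨⟨σ, hσ⟩, ⟨⟨ι, π⟩, h⟩⟩ ⟨⟨σ', hσ'⟩, ⟨⟨ι', π'⟩, h'⟩⟩ heq
      simp only [e, Sigma.mk.injEq] at heq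
      obtain ⟨e1, e2⟩ := heq
      have hm := h.mono
      have e4 : σ ≫ ι = σ' ≫ ι' := Subtype.ext_iff.1 e1
      have e3 : (⟨(ι, π), h⟩ : SES S E Z) = ⟨(ι', π'), h'⟩ := by
        have hp : ∀ a b : S ⟶ E, a = b → ∀ (x : {p : SES S E Z // a ≫ p.1.2 = 0})
            (y : {p : SES S E Z // b ≫ p.1.2 = 0}), x ≍ y → x.1 = y.1 := by
          rintro a _ rfl x y hxy
          rw [eq_of_heq hxy]
        exact hp _ _ e4 _ _ e2
      cases e3
      rw [cancel_mono] at e4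
      subst e4
      rfl
    · rintro ⟨⟨ι₂, h2⟩, ⟨⟨⟨ι, π⟩, h⟩, h0⟩⟩
      obtain ⟨σ, rfl⟩ := h.exists_lift ι₂ h0
      have hm' : Mono σ := mono_of_mono σ ι
      have hi : IsIso σ := isIso_of_mono_of_nonzero fun h0 =>
        id_nonzero S ((cancel_mono σ).1 (by rw [h0, comp_zero, comp_zero]))
      exact ⟨⟨⟨σ, hi⟩, ⟨(ι, π), h⟩⟩, rfl⟩
  rw [← Fintype.card_of_bijective he, Fintype.card_prod]
  push_cast
  ring

omit hf in
lemma sum_descs_zero [Simple S] (Z E : C) :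
    ∑ π₂ : EpiHom E S, f ⟦kernel π₂.1⟧ *
      Fintype.card {p : SES Z E S // p.1.1 ≫ π₂.1 = 0} =
      Fintype.card (IsoHom S S) * f ⟦Z⟧ * Fintype.card (SES Z E S) := by
  have hval (π₂ : EpiHom E S) : f ⟦kernel π₂.1⟧ *
      Fintype.card {p : SES Z E S // p.1.1 ≫ π₂.1 = 0} =
      Fintype.card {p : SES Z E S // p.1.1 ≫ π₂.1 = 0} * f ⟦Z⟧ := by
    obtain h | ⟨⟨⟨⟨κ, π⟩, h⟩, h0⟩⟩ := isEmpty_or_nonempty {p : SES Z E S // p.1.1 ≫ π₂.1 = 0}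
    · simp
    · obtain ⟨σ, hσ⟩ := h.exists_desc π₂.1 h0
      have hm := π₂.2
      have hm' : Epi σ := by
        have : Epi (π ≫ σ) := by rw [hσ]; exact hm
        exact epi_of_epi π σ
      have hi : IsIso σ := isIso_of_epi_of_nonzero fun h0 =>
        id_nonzero S ((cancel_epi σ).1 (by rw [h0, zero_comp, zero_comp]))
      have h2 : IsSES κ π₂.1 := hσ ▸ h.comp_iso σ
      obtain ⟨φ, -⟩ := (IsSES.kernel π₂.1).exists_iso_left h2
      rw [IsoClass.mk_eq_of_iso φ, mul_comm]
  simp_rw [hval]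
  rw [← Finset.sum_mul, ← Nat.cast_sum, ← Fintype.card_sigma]
  let e : IsoHom S S × SES Z E S →
      Σ π₂ : EpiHom E S, {p : SES Z E S // p.1.1 ≫ π₂.1 = 0} := fun x =>
    ⟨⟨x.2.1.2 ≫ x.1.1, have := x.1.2; have := x.2.2.epi; epi_comp _ _⟩,
      x.2, by rw [← Category.assoc, x.2.2.zero, zero_comp]⟩
  have he : Function.Bijective e := by
    constructor
    · rintro ⟨⟨σ, hσ⟩, ⟨⟨κ, π⟩, h⟩⟩ ⟨⟨σ', hσ'⟩, ⟨⟨κ', π'⟩, h'⟩⟩ heq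
      simp only [e, Sigma.mk.injEq] at heq
      obtain ⟨e1, e2⟩ := heq
      have hm := h.epi
      have e4 : π ≫ σ = π' ≫ σ' := Subtype.ext_iff.1 e1
      have e3 : (⟨(κ, π), h⟩ : SES Z E S) = ⟨(κ', π'), h'⟩ := by
        have hp : ∀ a b : E ⟶ S, a = b → ∀ (x : {p : SES Z E S // p.1.1 ≫ a = 0})
            (y : {p : SES Z E S // p.1.1 ≫ b = 0}), x ≍ y → x.1 = y.1 := by
          rintro a _ rfl x y hxy
          rw [eq_of_heq hxy]
        exact hp _ _ e4 _ _ e2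
      cases e3
      rw [cancel_epi] at e4
      subst e4
      rfl
    · rintro ⟨⟨π₂, h2⟩, ⟨⟨⟨κ, π⟩, h⟩, h0⟩⟩
      obtain ⟨σ, rfl⟩ := h.exists_desc π₂ h0
      have hm' : Epi σ := epi_of_epi π σ
      have hi : IsIso σ := isIso_of_epi_of_nonzero fun h0 =>
        id_nonzero S ((cancel_epi σ).1 (by rw [h0, zero_comp, zero_comp]))
      exact ⟨⟨⟨σ, hi⟩, ⟨(κ, π), h⟩⟩, rfl⟩
  rw [← Fintype.card_of_bijective he, Fintype.card_prod]
  push_cast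
  ring

/-- In the sum over extensions of `Z` by `S` with a second copy of `S` only the pairs of copies with
the same image survive. -/
lemma sum_ses_mul_quotSum [Simple S] (Z : C)
    (h : ∀ A : C, ∑ γ ∈ 𝓕, wt γ * f γ * Fintype.card (SES S γ.obj A) = 0)
    (𝓔 : Finset (IsoClass C))
    (h𝓔 : ∀ (E : C) (ι : S ⟶ E) (π : E ⟶ Z), IsSES ι π → ⟦E⟧ ∈ 𝓔) :
    ∑ E ∈ 𝓔, wt E * (Fintype.card (SES S E.obj Z) * quotSum S f E.obj) =
      Fintype.card (IsoHom S S) * f ⟦Z⟧ * ∑ E ∈ 𝓔, wt E * Fintype.card (SES S E.obj Z) := by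
  have key (E : C) : Fintype.card (SES S E Z) * quotSum S f E =
      ∑ j : S ⟶ Z, ∑ ι₂ : MonoHom S E, f ⟦cokernel ι₂.1⟧ *
        Fintype.card {p : SES S E Z // ι₂.1 ≫ p.1.2 = j} := by
    rw [Finset.sum_comm, quotSum, Finset.mul_sum]
    refine Finset.sum_congr rfl fun ι₂ _ => ?_
    rw [← Finset.mul_sum, ← Nat.cast_sum, ← Fintype.card_sigma, mul_comm,
      Fintype.card_congr (Equiv.sigmaFiberEquiv fun p : SES S E Z => ι₂.1 ≫ p.1.2)]
  simp_rw [key, Finset.mul_sum (s := (Finset.univ : Finset (S ⟶ Z)))]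
  rw [Finset.sum_comm, Finset.sum_eq_single_of_mem (0 : S ⟶ Z) (Finset.mem_univ _)]
  · simp_rw [sum_lifts_zero S f Z, Finset.mul_sum]
    exact Finset.sum_congr rfl fun E _ => by ring
  · intro j _ hj
    have := mono_of_nonzero_from_simple hj
    exact sum_lifts_eq_zero S f 𝓕 hf j h 𝓔 h𝓔

lemma sum_ses_mul_subSum [Simple S] (Z : C)
    (h : ∀ A : C, ∑ γ ∈ 𝓕, wt γ * f γ * Fintype.card (SES A γ.obj S) = 0)
    (𝓔 : Finset (IsoClass C))
    (h𝓔 : ∀ (E : C) (κ : Z ⟶ E) (π : E ⟶ S), IsSES κ π → ⟦E⟧ ∈ 𝓔) :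
    ∑ E ∈ 𝓔, wt E * (Fintype.card (SES Z E.obj S) * subSum S f E.obj) =
      Fintype.card (IsoHom S S) * f ⟦Z⟧ * ∑ E ∈ 𝓔, wt E * Fintype.card (SES Z E.obj S) := by
  have key (E : C) : Fintype.card (SES Z E S) * subSum S f E =
      ∑ j : Z ⟶ S, ∑ π₂ : EpiHom E S, f ⟦kernel π₂.1⟧ *
        Fintype.card {p : SES Z E S // p.1.1 ≫ π₂.1 = j} := by
    rw [Finset.sum_comm, subSum, Finset.mul_sum]
    refine Finset.sum_congr rfl fun π₂ _ => ?_
    rw [← Finset.mul_sum, ← Nat.cast_sum, ← Fintype.card_sigma, mul_comm,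
      Fintype.card_congr (Equiv.sigmaFiberEquiv fun p : SES Z E S => p.1.1 ≫ π₂.1)]
  simp_rw [key, Finset.mul_sum (s := (Finset.univ : Finset (Z ⟶ S)))]
  rw [Finset.sum_comm, Finset.sum_eq_single_of_mem (0 : Z ⟶ S) (Finset.mem_univ _)]
  · simp_rw [sum_descs_zero S f Z, Finset.mul_sum]
    exact Finset.sum_congr rfl fun E _ => by ring
  · intro j _ hj
    have := epi_of_nonzero_to_simple hj
    exact sum_descs_eq_zero S f 𝓕 hf j h 𝓔 h𝓔

end InnerProducts

section MixedInnerProduct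

open scoped Classical

variable {C : Type u} [Category.{v} C] [Abelian C]

lemma IsSES.biprod_inr_fst (Z S : C) : IsSES (biprod.inr : S ⟶ Z ⊞ S) biprod.fst :=
  IsSES.of_lift (by simp) fun t ht => ⟨t ≫ biprod.snd, by ext <;> simp [ht]⟩

lemma IsSES.biprod_inl_snd (Z S : C) : IsSES (biprod.inl : Z ⟶ Z ⊞ S) biprod.snd :=
  IsSES.of_lift (by simp) fun t ht => ⟨t ≫ biprod.fst, by ext <;> simp [ht]⟩

/-- A retraction of the subobject of an extension, up to an automorphism, splits the extension. -/
lemma IsSES.exists_biprod_iso {S E Z : C} {ι : S ⟶ E} {π : E ⟶ Z} (h : IsSES ι π) (π₂ : E ⟶ S)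
    [IsIso (ι ≫ π₂)] : ∃ φ : Z ⊞ S ≅ E, biprod.inr ≫ φ.hom = ι ∧ φ.inv ≫ biprod.fst = π ∧
      φ.inv ≫ biprod.snd ≫ ι ≫ π₂ = π₂ := by
  let c : E ⟶ Z ⊞ S := biprod.lift π (π₂ ≫ inv (ι ≫ π₂))
  have hc₁ : ι ≫ c = biprod.inr := by
    ext
    · simp [c, h.zero]
    · rw [Category.assoc, biprod.lift_snd, ← Category.assoc, IsIso.hom_inv_id, biprod.inr_snd]
  have hc₂ : c ≫ biprod.fst = π := by simp [c]
  have : IsIso c := h.isIso_of_comp (IsSES.biprod_inr_fst Z S) c hc₁ hc₂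
  refine ⟨(asIso c).symm, ?_, hc₂, ?_⟩
  · simp [← hc₁]
  · change c ≫ biprod.snd ≫ ι ≫ π₂ = π₂
    simp only [c, biprod.lift_snd_assoc, Category.assoc]
    rw [IsIso.inv_hom_id, Category.comp_id]

/-- Pairs consisting of an extension of `Z` by a simple object `S` and a morphism to `S` that is
nonzero on the subobject correspond to splittings of the middle term. -/
lemma bijective_splittings (S Z E : C) [Simple S] : Function.Bijective
    (fun x : IsoHom S S × IsoHom (Z ⊞ S) E =>
      (⟨⟨(biprod.inr ≫ x.2.1, have := x.2.2; inv x.2.1 ≫ biprod.fst),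
          have := x.2.2; (IsSES.biprod_inr_fst Z S).middle_iso (asIso x.2.1)⟩,
        ⟨⟨have := x.2.2; inv x.2.1 ≫ biprod.snd ≫ x.1.1,
          have := x.2.2; have := x.1.2; epi_comp _ _⟩, by
            have := x.2.2; have := x.1.2
            dsimp only
            rw [Category.assoc, IsIso.hom_inv_id_assoc, biprod.inr_snd_assoc]
            intro h
            exact id_nonzero S ((cancel_mono x.1.1).1 (by rw [Category.id_comp, h, zero_comp]))⟩⟩ :
        Σ p : SES S E Z, {π₂ : EpiHom E S // p.1.1 ≫ π₂.1 ≠ 0})) := by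
  have inj : ∀ (y y' : Σ p : SES S E Z, {π₂ : EpiHom E S // p.1.1 ≫ π₂.1 ≠ 0}),
      y = y' ↔ y.1 = y'.1 ∧ y.2.1 = y'.2.1 := by
    rintro ⟨y, q, hq⟩ ⟨y', q', hq'⟩
    constructor
    · intro h; cases h; exact ⟨rfl, rfl⟩
    · rintro ⟨h, h'⟩
      dsimp only at h h'
      subst h; subst h'; rfl
  constructor
  · rintro ⟨⟨σ, hσ⟩, ⟨φ, hφ⟩⟩ ⟨⟨σ', hσ'⟩, ⟨φ', hφ'⟩⟩ heq
    obtain ⟨e1, e2⟩ := (inj _ _).1 heq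
    obtain ⟨e3, e4⟩ := Prod.ext_iff.1 (Subtype.ext_iff.1 e1)
    have e5 := Subtype.ext_iff.1 e2
    dsimp only at e3 e4 e5
    have e6 : σ = σ' := by
      have h1 : (biprod.inr ≫ φ) ≫ inv φ ≫ biprod.snd ≫ σ = σ := by simp
      have h2 : (biprod.inr ≫ φ') ≫ inv φ' ≫ biprod.snd ≫ σ' = σ' := by simp
      rw [← h1, ← h2, e3, e5]
    subst e6
    have e7 : inv φ = inv φ' := by
      apply biprod.hom_ext _ _ e4
      rw [← cancel_mono σ, Category.assoc, Category.assoc, e5]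
    rw [IsIso.inv_eq_inv] at e7
    subst e7
    rfl
  · rintro ⟨⟨⟨ι, π⟩, h⟩, ⟨⟨π₂, h₂⟩, hne⟩⟩
    dsimp only at hne h
    have hepi := epi_of_nonzero_to_simple hne
    have hi : IsIso (ι ≫ π₂) := isIso_of_epi_of_nonzero hne
    obtain ⟨φ, h1, h2, h3⟩ := h.exists_biprod_iso π₂
    refine ⟨⟨⟨ι ≫ π₂, hi⟩, ⟨φ.hom, inferInstance⟩⟩, (inj _ _).2 ⟨?_, ?_⟩⟩
    · exact Subtype.ext (Prod.ext h1 (by simpa using h2))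
    · exact Subtype.ext (by simpa using h3)

variable [HasExt.{w} C] [∀ X Y : C, Finite (X ⟶ Y)] [∀ X Y : C, Finite (Ext.{w} X Y 1)]

attribute [local instance] homFintype extFintype

variable (S : C) (f : IsoClass C → ℝ) (𝓕 : Finset (IsoClass C)) (hf : ∀ γ ∉ 𝓕, f γ = 0)

omit [HasExt.{w} C] [∀ X Y : C, Finite (Ext.{w} X Y 1)] in
/-- For an extension `E` of `Z` by `S`, an epimorphism from `E` to `S` either factors through `Z` or
splits the extension. -/
lemma card_ses_mul_subSum [Simple S] (Z E : C) :
    Fintype.card (SES S E Z) * subSum S f E =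
      ∑ q : EpiHom Z S, ∑ p : SES S E Z, f ⟦kernel (p.1.2 ≫ q.1)⟧ +
        Fintype.card (IsoHom S S) * f ⟦Z⟧ * Fintype.card (IsoHom (Z ⊞ S) E) := by
  have h1 (p : SES S E Z) : ∑ π₂ : EpiHom E S with p.1.1 ≫ π₂.1 = 0, f ⟦kernel π₂.1⟧ =
      ∑ q : EpiHom Z S, f ⟦kernel (p.1.2 ≫ q.1)⟧ := by
    have := p.2.epi
    refine (Finset.sum_bij (fun q _ => ⟨p.1.2 ≫ q.1, have := q.2; epi_comp _ _⟩) ?_ ?_ ?_ ?_).symm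
    · intro q _
      simp [← Category.assoc, p.2.zero]
    · intro q _ q' _ h
      exact Subtype.ext ((cancel_epi p.1.2).1 (Subtype.ext_iff.1 h))
    · intro π₂ hπ₂
      obtain ⟨s, hs⟩ := p.2.exists_desc π₂.1 (Finset.mem_filter.1 hπ₂).2
      have h2 := π₂.2
      have : Epi (p.1.2 ≫ s) := by rw [hs]; exact h2
      exact ⟨⟨s, epi_of_epi p.1.2 s⟩, Finset.mem_univ _, Subtype.ext hs⟩
    · intro q _
      rfl
  have h2 (p : SES S E Z) : ∑ π₂ : EpiHom E S with ¬ p.1.1 ≫ π₂.1 = 0, f ⟦kernel π₂.1⟧ =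
      Fintype.card {π₂ : EpiHom E S // p.1.1 ≫ π₂.1 ≠ 0} * f ⟦Z⟧ := by
    rw [Fintype.card_subtype, ← nsmul_eq_mul, ← Finset.sum_const]
    refine Finset.sum_congr rfl fun π₂ hπ₂ => ?_
    have hne := (Finset.mem_filter.1 hπ₂).2
    have hepi := epi_of_nonzero_to_simple hne
    have hi : IsIso (p.1.1 ≫ π₂.1) := isIso_of_epi_of_nonzero hne
    obtain ⟨φ, -, -, h3⟩ := p.2.exists_biprod_iso π₂.1
    have hs : IsSES (biprod.inl ≫ φ.hom) π₂.1 := by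
      rw [← h3, ← Category.assoc]
      exact ((IsSES.biprod_inl_snd Z S).middle_iso φ).comp_iso _
    have := π₂.2
    obtain ⟨ψ, -⟩ := (IsSES.kernel π₂.1).exists_iso_left hs
    rw [IsoClass.mk_eq_of_iso ψ]
  have h3 : (∑ p : SES S E Z, (Fintype.card {π₂ : EpiHom E S // p.1.1 ≫ π₂.1 ≠ 0} : ℝ)) =
      Fintype.card (IsoHom S S) * Fintype.card (IsoHom (Z ⊞ S) E) := by
    rw [← Nat.cast_sum, ← Fintype.card_sigma,
      ← Fintype.card_of_bijective (bijective_splittings S Z E), Fintype.card_prod, Nat.cast_mul]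
  rw [Finset.sum_comm, mul_right_comm, ← h3, Finset.sum_mul, ← Finset.sum_add_distrib,
    ← nsmul_eq_mul, ← Finset.card_univ, ← Finset.sum_const]
  refine Finset.sum_congr rfl fun p _ => ?_
  rw [← h1, ← h2, Finset.sum_filter_add_sum_filter_not, subSum]

include hf in
/-- In the sum over extensions `E` of `Z` by `S` with an epimorphism `E ⟶ S` only the pairs with
nonzero composition `S ⟶ E ⟶ S` survive. -/
lemma sum_ses_mul_subSum_of_ext [Simple S] (Z : C) (hS : Subsingleton (Ext.{w} S S 2))
    (h : ∀ A : C, ∑ γ ∈ 𝓕, wt γ * f γ * Fintype.card (SES S γ.obj A) = 0)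
    (𝓔 : Finset (IsoClass C))
    (h𝓔 : ∀ (E : C) (ι : S ⟶ E) (π : E ⟶ Z), IsSES ι π → ⟦E⟧ ∈ 𝓔) :
    ∑ E ∈ 𝓔, wt E * (Fintype.card (SES S E.obj Z) * subSum S f E.obj) =
      Fintype.card (IsoHom S S) * f ⟦Z⟧ := by
  have h1 : ∑ E ∈ 𝓔, wt E * ∑ q : EpiHom Z S, ∑ p : SES S E.obj Z, f ⟦kernel (p.1.2 ≫ q.1)⟧ =
      0 := by
    simp_rw [Finset.mul_sum (s := (Finset.univ : Finset (EpiHom Z S)))]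
    rw [Finset.sum_comm]
    refine Finset.sum_eq_zero fun q _ => ?_
    have := q.2
    exact sum_ses_kernel_comp_eq_zero S Z hS f 𝓕 hf h 𝓔 h𝓔 q.1
  have h2 := sum_wt_mul_card_isoHom (Z ⊞ S) 𝓔 (fun _ => Fintype.card (IsoHom S S) * f ⟦Z⟧)
    (fun h => absurd (h𝓔 _ _ _ (IsSES.biprod_inr_fst Z S)) h)
  simp_rw [card_ses_mul_subSum, mul_add, Finset.sum_add_distrib, h1, zero_add]
  refine Eq.trans (Finset.sum_congr rfl fun E _ => ?_) h2
  ring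

include hf in
/-- A function `f` orthogonal to all Hall products with the simple class `S` on either side vanishes
as soon as `|Ext¹(γ, S)| |Ext¹(S, γ)| < |Hom(γ, S)| |Hom(S, γ)|` on its support: this is the
Cauchy-Schwarz inequality for the products of `f` with the class of `S` on the two sides. -/
lemma eq_zero_of_orthogonal [Simple S] (hS : Subsingleton (Ext.{w} S S 2))
    (h₁ : ∀ A : C, ∑ γ ∈ 𝓕, wt γ * f γ * Fintype.card (SES S γ.obj A) = 0)
    (h₂ : ∀ A : C, ∑ γ ∈ 𝓕, wt γ * f γ * Fintype.card (SES A γ.obj S) = 0) (r l : ℝ)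
    (hr : ∀ γ ∈ 𝓕, (Fintype.card (Ext.{w} γ.obj S 1) : ℝ) / Fintype.card (γ.obj ⟶ S) = r)
    (hl : ∀ γ ∈ 𝓕, (Fintype.card (Ext.{w} S γ.obj 1) : ℝ) / Fintype.card (S ⟶ γ.obj) = l)
    (hrl : r * l < 1) (γ : IsoClass C) : f γ = 0 := by
  let 𝓔 : Finset (IsoClass C) := 𝓕.biUnion fun γ =>
    (finite_middle_terms.{w} S γ.obj).toFinset ∪ (finite_middle_terms.{w} γ.obj S).toFinset
  have h𝓔₁ : ∀ γ ∈ 𝓕, ∀ (E : C) (ι : S ⟶ E) (π : E ⟶ γ.obj), IsSES ι π → ⟦E⟧ ∈ 𝓔 := by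
    intro γ hγ E ι π hE
    obtain ⟨e⟩ := IsoClass.nonempty_iso_obj E
    exact Finset.mem_biUnion.2 ⟨γ, hγ, Finset.mem_union_left _
      ((Set.Finite.mem_toFinset _).2 ⟨_, _, hE.middle_iso e⟩)⟩
  have h𝓔₂ : ∀ γ ∈ 𝓕, ∀ (E : C) (ι : γ.obj ⟶ E) (π : E ⟶ S), IsSES ι π → ⟦E⟧ ∈ 𝓔 := by
    intro γ hγ E ι π hE
    obtain ⟨e⟩ := IsoClass.nonempty_iso_obj E
    exact Finset.mem_biUnion.2 ⟨γ, hγ, Finset.mem_union_right _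
      ((Set.Finite.mem_toFinset _).2 ⟨_, _, hE.middle_iso e⟩)⟩
  set N : ℝ := ∑ γ ∈ 𝓕, wt γ * f γ ^ 2
  set a : ℝ := (Fintype.card (IsoHom S S) : ℝ)
  have ha : 0 < a := Nat.cast_pos.2 (card_isoHom_self_pos S)
  have hRR : ∑ E ∈ 𝓔, wt E * quotSum S f E.obj ^ 2 = a * r * N := by
    simp_rw [pow_two (quotSum S f _)]
    rw [sum_quotSum_mul S f 𝓕 hf 𝓔 (quotSum S f), Finset.mul_sum]
    refine Finset.sum_congr rfl fun γ hγ => ?_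
    rw [sum_ses_mul_quotSum S f 𝓕 hf γ.obj h₁ 𝓔 (h𝓔₁ γ hγ),
      sum_wt_mul_card_ses.{w} S γ.obj 𝓔 (h𝓔₁ γ hγ), hr γ hγ, IsoClass.mk_obj]
    ring
  have hLL : ∑ E ∈ 𝓔, wt E * subSum S f E.obj ^ 2 = a * l * N := by
    simp_rw [pow_two (subSum S f _)]
    rw [sum_subSum_mul S f 𝓕 hf 𝓔 (subSum S f), Finset.mul_sum]
    refine Finset.sum_congr rfl fun γ hγ => ?_
    rw [sum_ses_mul_subSum S f 𝓕 hf γ.obj h₂ 𝓔 (h𝓔₂ γ hγ),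
      sum_wt_mul_card_ses.{w} γ.obj S 𝓔 (h𝓔₂ γ hγ), hl γ hγ, IsoClass.mk_obj]
    ring
  have hRL : ∑ E ∈ 𝓔, wt E * (quotSum S f E.obj * subSum S f E.obj) = a * N := by
    rw [sum_quotSum_mul S f 𝓕 hf 𝓔 (subSum S f), Finset.mul_sum]
    refine Finset.sum_congr rfl fun γ hγ => ?_
    rw [sum_ses_mul_subSum_of_ext S f 𝓕 hf γ.obj hS h₁ 𝓔 (h𝓔₁ γ hγ), IsoClass.mk_obj]
    ring
  have hCS := Finset.sum_sq_le_sum_mul_sum_of_sq_le_mul 𝓔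
    (r := fun E => wt E * (quotSum S f E.obj * subSum S f E.obj))
    (f := fun E => wt E * quotSum S f E.obj ^ 2) (g := fun E => wt E * subSum S f E.obj ^ 2)
    (fun E _ => mul_nonneg (wt_pos E).le (sq_nonneg _))
    (fun E _ => mul_nonneg (wt_pos E).le (sq_nonneg _)) (fun E _ => le_of_eq (by ring))
  rw [hRR, hLL, hRL] at hCS
  have hN0 : ∀ γ ∈ 𝓕, 0 ≤ wt γ * f γ ^ 2 := fun γ _ => mul_nonneg (wt_pos γ).le (sq_nonneg _)
  have hN : N = 0 := by
    by_contra hne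
    have : 0 < N := lt_of_le_of_ne (Finset.sum_nonneg hN0) (Ne.symm hne)
    nlinarith [mul_pos (pow_pos ha 2) (pow_pos this 2)]
  by_cases hγ : γ ∈ 𝓕
  · have := (Finset.sum_eq_zero_iff_of_nonneg hN0).1 hN γ hγ
    exact pow_eq_zero_iff two_ne_zero |>.1 ((mul_eq_zero.1 this).resolve_left (wt_pos γ).ne')
  · exact hf γ hγ

end MixedInnerProduct

/-! ### Composition factors -/

section CompositionFactors

variable {C : Type u} [Category.{v} C] [Abelian C]

lemma IsSES.comp_of_isPullback {E L Y M W : C} {q₁ : E ⟶ L} {q₂ : E ⟶ M} {f : L ⟶ Y} {p : M ⟶ Y}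
    (sq : IsPullback q₁ q₂ f p) [Epi p] {c : Y ⟶ W} (h : IsSES f c) : IsSES q₂ (p ≫ c) := by
  have hf := h.mono
  have hc := h.epi
  have hq : Mono q₂ := by rw [← sq.isoPullback_hom_snd]; infer_instance
  have : Epi (p ≫ c) := epi_comp _ _
  refine IsSES.of_lift (by rw [← Category.assoc, ← sq.w, Category.assoc, h.zero, comp_zero])
    fun t ht => ?_
  obtain ⟨s, hs⟩ := h.exists_lift (t ≫ p) (by rw [Category.assoc, ht])
  exact ⟨sq.lift s t hs, sq.lift_snd _ _ _⟩

lemma IsSES.comp_of_isPushout {E L Y M W : C} {k₁ : L ⟶ E} {k₂ : M ⟶ E} {π : Y ⟶ L} {f : Y ⟶ M}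
    (sq : IsPushout π f k₁ k₂) [Mono f] {k : W ⟶ Y} (h : IsSES k π) : IsSES (k ≫ f) k₂ := by
  have hf := h.mono
  have hc := h.epi
  have hq : Epi k₂ := by rw [← sq.inr_isoPushout_inv]; infer_instance
  have : Mono (k ≫ f) := mono_comp _ _
  refine IsSES.of_desc (by rw [Category.assoc, ← sq.w, ← Category.assoc, h.zero, zero_comp])
    fun t ht => ?_
  obtain ⟨s, hs⟩ := h.exists_desc (f ≫ t) (by rw [← Category.assoc, ht])
  exact ⟨sq.desc s t hs, sq.inr_desc _ _ _⟩

lemma SimpleClass.eq_of_iso {i j : SimpleClass C} (e : i.1.obj ≅ j.1.obj) : i = j :=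
  Subtype.ext ((IsoClass.mk_obj _).symm.trans (IsoClass.eq_of_iso_obj e))

namespace HasCompFactors

lemma of_iso {M N : C} {d : SimpleClass C →₀ ℕ} (h : HasCompFactors M d) (φ : M ≅ N) :
    HasCompFactors N d := by
  cases h with
  | zero hM => exact zero (hM.of_iso φ.symm)
  | step f hf i e hL =>
    exact step (f ≫ φ.hom) inferInstance i (cokernelCompIsIso f φ.hom ≪≫ e) hL

lemma of_isSES {L M : C} {d : SimpleClass C →₀ ℕ} (hL : HasCompFactors L d) (i : SimpleClass C)
    {f : L ⟶ M} {c : M ⟶ i.1.obj} (h : IsSES f c) :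
    HasCompFactors M (d + Finsupp.single i 1) := by
  have := h.mono
  obtain ⟨e, -⟩ := (IsSES.cokernel f).exists_iso_right h
  exact step f ‹_› i e hL

/-- Induction along a composition series, with the last step given as a short exact sequence. -/
lemma rec_isSES {motive : C → (SimpleClass C →₀ ℕ) → Prop}
    (zero : ∀ M : C, IsZero M → motive M 0)
    (step : ∀ (L M : C) (d : SimpleClass C →₀ ℕ) (i : SimpleClass C) (f : L ⟶ M) (c : M ⟶ i.1.obj),
      IsSES f c → HasCompFactors L d → motive L d → motive M (d + Finsupp.single i 1))
    {M : C} {d : SimpleClass C →₀ ℕ} (h : HasCompFactors M d) : motive M d := by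
  induction h with
  | zero hM => exact zero _ hM
  | step f hf i e hL ih =>
    exact step _ _ _ i f (cokernel.π f ≫ e.hom) ((IsSES.cokernel f).comp_iso _) hL ih

lemma add {X E Y : C} {ι : X ⟶ E} {π : E ⟶ Y} (h : IsSES ι π) {a b : SimpleClass C →₀ ℕ}
    (hX : HasCompFactors X a) (hY : HasCompFactors Y b) : HasCompFactors E (b + a) := by
  revert E
  refine rec_isSES (motive := fun Y b => ∀ {E : C} {ι : X ⟶ E} {π : E ⟶ Y},
    IsSES ι π → HasCompFactors E (b + a)) ?_ ?_ hY
  · intro Y hY E ι π h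
    have := h.mono
    obtain ⟨s, hs⟩ := h.exists_lift (𝟙 E) (hY.eq_of_tgt _ _)
    have : Epi ι := by
      have : Epi (s ≫ ι) := by rw [hs]; infer_instance
      exact epi_of_epi s ι
    have := isIso_of_mono_of_epi ι
    rw [zero_add]
    exact hX.of_iso (asIso ι)
  · intro L Y d i f c hfc _ ih E ι π h
    have sq := IsPullback.of_hasPullback f π
    have := h.epi
    rw [add_right_comm]
    exact (ih (IsSES.of_isPullback sq h)).of_isSES i (IsSES.comp_of_isPullback sq hfc)

/-- A simple quotient `M / L` can be taken as the last step of a composition series. -/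
lemma exists_of_isSES {M : C} {d : SimpleClass C →₀ ℕ} (h : HasCompFactors M d) {L : C}
    {j : SimpleClass C} {g : L ⟶ M} {c : M ⟶ j.1.obj} (hg : IsSES g c) :
    ∃ d', HasCompFactors L d' ∧ d = d' + Finsupp.single j 1 := by
  revert L j
  refine rec_isSES (motive := fun M d => ∀ {L : C} {j : SimpleClass C} {g : L ⟶ M}
    {c : M ⟶ j.1.obj}, IsSES g c → ∃ d', HasCompFactors L d' ∧ d = d' + Finsupp.single j 1) ?_ ?_ h
  · intro M hM L j g c hg
    have := hg.epi
    have := j.2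
    exact absurd (IsZero.of_epi c hM) (Simple.not_isZero _)
  · intro L₀ M d i f c₀ hf hL₀ ih L j g c hg
    have hi := i.2
    have hj := j.2
    have hgm := hg.mono
    have hce := hg.epi
    have hfm := hf.mono
    have hc₀e := hf.epi
    by_cases h0 : f ≫ c = 0
    · -- The two maximal subobjects agree.
      obtain ⟨r, hr⟩ := hf.exists_desc c h0
      have hre : Epi r := by
        have : Epi (c₀ ≫ r) := by rw [hr]; exact hce
        exact epi_of_epi c₀ r
      have hr0 : r ≠ 0 := by
        rintro rfl
        rw [comp_zero] at hr
        exact id_nonzero j.1.obj ((cancel_epi c).1 (by rw [← hr, zero_comp, zero_comp]))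
      have hri : IsIso r := isIso_of_epi_of_nonzero hr0
      obtain rfl : i = j := SimpleClass.eq_of_iso (asIso r)
      have hf' : IsSES f c := hr ▸ hf.comp_iso r
      obtain ⟨φ, -⟩ := hf'.exists_iso_left hg
      exact ⟨d, hL₀.of_iso φ.symm, rfl⟩
    · -- The intersection `K` of the two maximal subobjects is maximal in both.
      have hfe : Epi (f ≫ c) := epi_of_nonzero_to_simple h0
      obtain ⟨d', hK, rfl⟩ := ih (IsSES.kernel (f ≫ c))
      have hg0 : g ≫ c₀ ≠ 0 := by
        intro h1
        obtain ⟨r, hr⟩ := hg.exists_desc c₀ h1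
        have hre : Epi r := by
          have : Epi (c ≫ r) := by rw [hr]; exact hc₀e
          exact epi_of_epi c r
        have hr0 : r ≠ 0 := by
          rintro rfl
          rw [comp_zero] at hr
          exact id_nonzero i.1.obj ((cancel_epi c₀).1 (by rw [← hr, zero_comp, zero_comp]))
        have hri : IsIso r := isIso_of_epi_of_nonzero hr0
        apply h0
        rw [← cancel_mono r, Category.assoc, hr, hf.zero, zero_comp]
      have hge : Epi (g ≫ c₀) := epi_of_nonzero_to_simple hg0
      obtain ⟨k, hk⟩ := hg.exists_lift (kernel.ι (f ≫ c) ≫ f)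
        (by rw [Category.assoc, kernel.condition])
      have hkm : Mono k := by
        have : Mono (k ≫ g) := by rw [hk]; infer_instance
        exact mono_of_mono k g
      have hkc : IsSES k (g ≫ c₀) := by
        refine IsSES.of_lift (by rw [← Category.assoc, hk, Category.assoc, hf.zero, comp_zero])
          fun t ht => ?_
        obtain ⟨s, hs⟩ := hf.exists_lift (t ≫ g) (by rw [Category.assoc, ht])
        refine ⟨kernel.lift (f ≫ c) s ?_, ?_⟩
        · rw [← Category.assoc, hs, Category.assoc, hg.zero, comp_zero]
        · rw [← cancel_mono g, Category.assoc, hk, kernel.lift_ι_assoc, hs]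
      exact ⟨_, hK.of_isSES i hkc, add_right_comm _ _ _⟩

/-- The Jordan-Hölder theorem. -/
lemma unique {M : C} {d d' : SimpleClass C →₀ ℕ} (h : HasCompFactors M d)
    (h' : HasCompFactors M d') : d = d' := by
  revert d'
  refine rec_isSES (motive := fun M d => ∀ {d'}, HasCompFactors M d' → d = d') ?_ ?_ h
  · intro M hM d' h'
    revert hM
    refine rec_isSES (motive := fun M d' => IsZero M → 0 = d') (fun _ _ _ => rfl) ?_ h'
    intro L M d i f c hfc _ _ hM
    have := hfc.epi
    have := i.2
    exact absurd (IsZero.of_epi c hM) (Simple.not_isZero _)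
  · intro L M d i f c hfc _ ih d' h'
    obtain ⟨d'', hL, rfl⟩ := h'.exists_of_isSES hfc
    rw [ih hL]

lemma dimVec_eq {M : C} {d : SimpleClass C →₀ ℕ} (h : HasCompFactors M d) : dimVec M = d := by
  have hex : ∃ d, HasCompFactors M d := ⟨d, h⟩
  rw [dimVec, dif_pos hex]
  exact hex.choose_spec.unique h

open ZeroObject in
lemma simple (i : SimpleClass C) : HasCompFactors i.1.obj (Finsupp.single i 1) := by
  have h : IsSES (0 : (0 : C) ⟶ i.1.obj) (𝟙 i.1.obj) :=
    IsSES.of_lift (by simp) fun t ht => ⟨0, by simpa using ht.symm⟩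
  simpa using (HasCompFactors.zero (isZero_zero C)).of_isSES i h

end HasCompFactors

lemma hasCompFactors_dimVec (hC : IsLengthCategory C) (M : C) : HasCompFactors M (dimVec M) := by
  obtain ⟨d, hd⟩ := hC M
  rwa [hd.dimVec_eq]

lemma IsSES.dimVec_eq (hC : IsLengthCategory C) {X E Y : C} {ι : X ⟶ E} {π : E ⟶ Y}
    (h : IsSES ι π) : dimVec E = dimVec Y + dimVec X :=
  (HasCompFactors.add h (hasCompFactors_dimVec hC X) (hasCompFactors_dimVec hC Y)).dimVec_eq

lemma dimVec_congr {M N : C} (hC : IsLengthCategory C) (e : M ≅ N) : dimVec M = dimVec N :=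
  ((hasCompFactors_dimVec hC N).of_iso e.symm).dimVec_eq

variable [HasExt.{w} C]

/-- Vanishing of `Ext¹` between composition factors is inherited by objects of finite length. -/
lemma HasCompFactors.subsingleton_ext {M N : C} {d e : SimpleClass C →₀ ℕ}
    (hM : HasCompFactors M d) (hN : HasCompFactors N e)
    (h : ∀ i ∈ d.support, ∀ j ∈ e.support, Subsingleton (Ext.{w} i.1.obj j.1.obj 1)) :
    Subsingleton (Ext.{w} M N 1) := by
  have step1 (i : SimpleClass C) (hi : i ∈ d.support) : Subsingleton (Ext.{w} i.1.obj N 1) := by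
    have h' := h i hi
    clear h
    revert h'
    refine rec_isSES (motive := fun N e => (∀ j ∈ e.support,
      Subsingleton (Ext.{w} i.1.obj j.1.obj 1)) → Subsingleton (Ext.{w} i.1.obj N 1)) ?_ ?_ hN
    · intro N hN _
      refine ⟨fun x y => ?_⟩
      rw [← Ext.comp_mk₀_id x, ← Ext.comp_mk₀_id y, hN.eq_of_src (𝟙 N) 0, Ext.mk₀_zero,
        Ext.comp_zero, Ext.comp_zero]
    · intro L N e j f c hfc _ ih h'
      have h1 := ih fun j hj => h' j (by
        rw [Finsupp.mem_support_iff] at hj ⊢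
        rw [Finsupp.add_apply]
        exact Nat.ne_of_gt (Nat.add_pos_left (Nat.pos_of_ne_zero hj) _))
      have h2 := h' j (by simp)
      refine subsingleton_of_forall_eq 0 fun x => ?_
      obtain ⟨y, rfl⟩ := Ext.covariant_sequence_exact₂ _ hfc.2 x (Subsingleton.elim _ _)
      rw [Subsingleton.elim y 0, Ext.zero_comp]
  clear h
  revert step1
  refine rec_isSES (motive := fun M d => (∀ i ∈ d.support,
    Subsingleton (Ext.{w} i.1.obj N 1)) → Subsingleton (Ext.{w} M N 1)) ?_ ?_ hM
  · intro M hM _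
    refine ⟨fun x y => ?_⟩
    rw [← Ext.mk₀_id_comp x, ← Ext.mk₀_id_comp y, hM.eq_of_src (𝟙 M) 0, Ext.mk₀_zero,
      Ext.zero_comp, Ext.zero_comp]
  · intro L M d j f c hfc _ ih h'
    have h1 := ih fun j hj => h' j (by
      rw [Finsupp.mem_support_iff] at hj ⊢
      rw [Finsupp.add_apply]
      exact Nat.ne_of_gt (Nat.add_pos_left (Nat.pos_of_ne_zero hj) _))
    have h2 := h' j (by simp)
    refine subsingleton_of_forall_eq 0 fun x => ?_
    obtain ⟨y, rfl⟩ := Ext.contravariant_sequence_exact₂ hfc.2 _ x (Subsingleton.elim _ _)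
    rw [Subsingleton.elim y 0, Ext.comp_zero]

/-- If `Ext¹(i, j) = 0` for all composition factors `i ∉ P`, `j ∈ P` of `M`, then `M` has a
subobject whose composition factors are those of `M` outside `P`. -/
lemma HasCompFactors.exists_isSES_of_ext_eq_zero (P : Set (SimpleClass C)) {M : C}
    {d : SimpleClass C →₀ ℕ} (hM : HasCompFactors M d)
    (h : ∀ i ∈ d.support, i ∉ P → ∀ j ∈ d.support, j ∈ P →
      Subsingleton (Ext.{w} i.1.obj j.1.obj 1)) :
    ∃ (X Y : C) (a b : SimpleClass C →₀ ℕ) (ι : X ⟶ M) (π : M ⟶ Y), IsSES ι π ∧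
      HasCompFactors X a ∧ HasCompFactors Y b ∧ (∀ i ∈ a.support, i ∉ P) ∧
      (∀ i ∈ b.support, i ∈ P) ∧ d = b + a := by
  revert h
  refine rec_isSES (motive := fun M d => (∀ i ∈ d.support, i ∉ P → ∀ j ∈ d.support, j ∈ P →
      Subsingleton (Ext.{w} i.1.obj j.1.obj 1)) →
    ∃ (X Y : C) (a b : SimpleClass C →₀ ℕ) (ι : X ⟶ M) (π : M ⟶ Y), IsSES ι π ∧
      HasCompFactors X a ∧ HasCompFactors Y b ∧ (∀ i ∈ a.support, i ∉ P) ∧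
      (∀ i ∈ b.support, i ∈ P) ∧ d = b + a) ?_ ?_ hM
  · intro M hM _
    refine ⟨M, M, 0, 0, 𝟙 M, 0, ?_, .zero hM, .zero hM, by simp, by simp, by simp⟩
    have : Epi (0 : M ⟶ M) := ⟨fun _ _ _ => hM.eq_of_src _ _⟩
    exact IsSES.of_lift (by simp) fun t _ => ⟨t, Category.comp_id t⟩
  · intro L M d i f c hfc _ ih h
    have hmono : ∀ j ∈ d.support, j ∈ (d + Finsupp.single i 1).support := fun j hj => by
      rw [Finsupp.mem_support_iff] at hj ⊢
      rw [Finsupp.add_apply]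
      exact Nat.ne_of_gt (Nat.add_pos_left (Nat.pos_of_ne_zero hj) _)
    obtain ⟨X, Y, a, b, k, p, hkp, hX, hY, ha, hb, rfl⟩ := ih fun j hj hjP l hl hlP =>
      h j (hmono j hj) hjP l (hmono l hl) hlP
    have hfm := hfc.mono
    -- `Q = M / X` is an extension of `i` by `Y`.
    have sq := IsPushout.of_hasPushout p f
    have hQ := IsSES.of_isPushout sq hfc
    have hXM := IsSES.comp_of_isPushout sq hkp
    have hsupp : ∀ (e : SimpleClass C →₀ ℕ) (R : SimpleClass C → Prop), (∀ j ∈ e.support, R j) →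
        R i → ∀ j ∈ (e + Finsupp.single i 1).support, R j := by
      intro e R he hi j hj
      by_cases hji : j = i
      · exact hji ▸ hi
      · refine he j ?_
        rw [Finsupp.mem_support_iff] at hj ⊢
        rwa [Finsupp.add_apply, Finsupp.single_eq_of_ne hji, add_zero] at hj
    by_cases hi : i ∈ P
    · exact ⟨X, _, a, b + Finsupp.single i 1, _, _, hXM, hX, hY.of_isSES i hQ, ha,
        hsupp b _ hb hi, add_right_comm _ _ _⟩
    · -- The extension `Q` splits, and the subobject is the preimage of `i` in `M`.
      have hsub : Subsingleton (Ext.{w} i.1.obj Y 1) :=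
        (HasCompFactors.simple i).subsingleton_ext hY fun j hj l hl => by
          obtain rfl : j = i := by simpa using hj
          refine h j (by simp) hi l (hmono l ?_) (hb l hl)
          rw [Finsupp.mem_support_iff] at hl ⊢
          rw [Finsupp.add_apply]
          exact Nat.ne_of_gt (Nat.add_pos_left (Nat.pos_of_ne_zero hl) _)
      obtain ⟨φ, -, -⟩ := hQ.exists_iso_of_extClass_eq (IsSES.biprod_inr_fst i.1.obj Y)
        (Subsingleton.elim _ _)
      have hs := (IsSES.biprod_inl_snd i.1.obj Y).middle_iso φ.symm
      have sq' := IsPullback.of_hasPullback (biprod.inl ≫ φ.symm.hom) (pushout.inr p f)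
      have := hXM.epi
      exact ⟨_, Y, a + Finsupp.single i 1, b, _, _, IsSES.comp_of_isPullback sq' hs,
        hX.of_isSES i (IsSES.of_isPullback sq' hXM), hY, hsupp a _ ha hi, hb,
        add_assoc _ _ _⟩

end CompositionFactors

/-! ### The Euler form -/

section EulerForm

lemma card_eq_card_ker_mul_card_range {G H : Type*} [AddCommGroup G] [AddCommGroup H]
    (g : G →+ H) : Nat.card G = Nat.card g.ker * Nat.card g.range := by
  rw [AddSubgroup.card_eq_card_quotient_mul_card_addSubgroup g.ker, mul_comm,
    Nat.card_congr (QuotientAddGroup.quotientKerEquivRange g).toEquiv]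

/-- The alternating product of the orders in an exact sequence
`0 ⟶ G₀ ⟶ G₁ ⟶ G₂ ⟶ G₃ ⟶ G₄ ⟶ G₅ ⟶ 0` is one. -/
lemma card_mul_card_mul_card_of_exact {G₀ G₁ G₂ G₃ G₄ G₅ : Type*} [AddCommGroup G₀]
    [AddCommGroup G₁] [AddCommGroup G₂] [AddCommGroup G₃] [AddCommGroup G₄] [AddCommGroup G₅]
    (g₀ : G₀ →+ G₁) (g₁ : G₁ →+ G₂) (g₂ : G₂ →+ G₃) (g₃ : G₃ →+ G₄) (g₄ : G₄ →+ G₅)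
    (h₀ : Function.Injective g₀) (h₁ : g₁.ker = g₀.range) (h₂ : g₂.ker = g₁.range)
    (h₃ : g₃.ker = g₂.range) (h₄ : g₄.ker = g₃.range) (h₅ : Function.Surjective g₄) :
    Nat.card G₀ * Nat.card G₂ * Nat.card G₄ = Nat.card G₁ * Nat.card G₃ * Nat.card G₅ := by
  have e₀ : Nat.card G₀ = Nat.card g₀.range :=
    Nat.card_congr (AddMonoidHom.ofInjective h₀).toEquiv
  have e₅ : Nat.card G₅ = Nat.card g₄.range := by
    rw [AddMonoidHom.range_eq_top.2 h₅]
    exact (Nat.card_congr AddSubgroup.topEquiv.toEquiv).symm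
  rw [e₀, e₅, card_eq_card_ker_mul_card_range g₁, card_eq_card_ker_mul_card_range g₂,
    card_eq_card_ker_mul_card_range g₃, card_eq_card_ker_mul_card_range g₄, h₁, h₂, h₃, h₄]
  ring

variable {C : Type u} [Category.{v} C] [Abelian C] [HasExt.{w} C]

lemma card_ext_zero (X Y : C) : Nat.card (Ext.{w} X Y 0) = Nat.card (X ⟶ Y) :=
  Nat.card_congr Ext.addEquiv₀.toEquiv

lemma IsSES.card_contravariant {X E Y : C} {ι : X ⟶ E} {π : E ⟶ Y} (h : IsSES ι π) (S : C)
    (hS : Subsingleton (Ext.{w} Y S 2)) :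
    Nat.card (Y ⟶ S) * Nat.card (X ⟶ S) * Nat.card (Ext.{w} E S 1) =
      Nat.card (E ⟶ S) * Nat.card (Ext.{w} Y S 1) * Nat.card (Ext.{w} X S 1) := by
  rw [← card_ext_zero.{w} Y, ← card_ext_zero.{w} X, ← card_ext_zero.{w} E]
  have := h.epi
  refine card_mul_card_mul_card_of_exact ((Ext.mk₀ π).precomp S (zero_add 0))
    ((Ext.mk₀ ι).precomp S (zero_add 0)) (h.extClass.precomp S (add_zero 1))
    ((Ext.mk₀ π).precomp S (zero_add 1)) ((Ext.mk₀ ι).precomp S (zero_add 1))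
    (Ext.precomp_mk₀_injective_of_epi S π) ?_ ?_ ?_ ?_ ?_
  · exact ((ShortComplex.ab_exact_iff_function_exact _).1
      (Ext.contravariant_sequence_exact₂' h.2 S 0)).addMonoidHom_ker_eq
  · exact ((ShortComplex.ab_exact_iff_function_exact _).1
      (Ext.contravariant_sequence_exact₁' h.2 S 0 1 rfl)).addMonoidHom_ker_eq
  · exact ((ShortComplex.ab_exact_iff_function_exact _).1
      (Ext.contravariant_sequence_exact₃' h.2 S 0 1 rfl)).addMonoidHom_ker_eq
  · exact ((ShortComplex.ab_exact_iff_function_exact _).1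
      (Ext.contravariant_sequence_exact₂' h.2 S 1)).addMonoidHom_ker_eq
  · intro x
    exact Ext.contravariant_sequence_exact₁ h.2 S x (n₁ := 2) rfl (Subsingleton.elim _ _)

lemma IsSES.card_covariant {X E Y : C} {ι : X ⟶ E} {π : E ⟶ Y} (h : IsSES ι π) (S : C)
    (hS : Subsingleton (Ext.{w} S X 2)) :
    Nat.card (S ⟶ X) * Nat.card (S ⟶ Y) * Nat.card (Ext.{w} S E 1) =
      Nat.card (S ⟶ E) * Nat.card (Ext.{w} S X 1) * Nat.card (Ext.{w} S Y 1) := by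
  rw [← card_ext_zero.{w} S Y, ← card_ext_zero.{w} S X, ← card_ext_zero.{w} S E]
  have := h.mono
  refine card_mul_card_mul_card_of_exact ((Ext.mk₀ ι).postcomp S (add_zero 0))
    ((Ext.mk₀ π).postcomp S (add_zero 0)) (h.extClass.postcomp S (zero_add 1))
    ((Ext.mk₀ ι).postcomp S (add_zero 1)) ((Ext.mk₀ π).postcomp S (add_zero 1))
    (Ext.postcomp_mk₀_injective_of_mono S ι) ?_ ?_ ?_ ?_ ?_
  · exact ((ShortComplex.ab_exact_iff_function_exact _).1
      (Ext.covariant_sequence_exact₂' S h.2 0)).addMonoidHom_ker_eq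
  · exact ((ShortComplex.ab_exact_iff_function_exact _).1
      (Ext.covariant_sequence_exact₃' S h.2 0 1 rfl)).addMonoidHom_ker_eq
  · exact ((ShortComplex.ab_exact_iff_function_exact _).1
      (Ext.covariant_sequence_exact₁' S h.2 0 1 rfl)).addMonoidHom_ker_eq
  · exact ((ShortComplex.ab_exact_iff_function_exact _).1
      (Ext.covariant_sequence_exact₂' S h.2 1)).addMonoidHom_ker_eq
  · intro x
    exact Ext.covariant_sequence_exact₃ S h.2 x (n₁ := 2) rfl (Subsingleton.elim _ _)

variable (k : Type t) [Field k] [Linear k C]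

/-- The Euler form on objects. -/
noncomputable def eulerObj (X Y : C) : ℤ :=
  (Module.finrank k (X ⟶ Y) : ℤ) - (Module.finrank k (Ext.{w} X Y 1) : ℤ)

variable [Finite k] (hHom : ∀ X Y : C, Module.Finite k (X ⟶ Y))
  (hExt : ∀ X Y : C, Module.Finite k (Ext.{w} X Y 1))

include hHom hExt

lemma IsSES.eulerObj_left {X E Y : C} {ι : X ⟶ E} {π : E ⟶ Y} (h : IsSES ι π) (S : C)
    (hS : Subsingleton (Ext.{w} Y S 2)) :
    eulerObj.{t, w} k E S = eulerObj.{t, w} k X S + eulerObj.{t, w} k Y S := by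
  have hc := h.card_contravariant.{w} S hS
  have h₀ (A B : C) := Module.natCard_eq_pow_finrank (K := k) (V := (A ⟶ B))
  have h₁ (A B : C) := Module.natCard_eq_pow_finrank (K := k) (V := Ext.{w} A B 1)
  rw [h₀, h₀, h₀, h₁, h₁, h₁, ← pow_add, ← pow_add, ← pow_add, ← pow_add] at hc
  have := Nat.pow_right_injective (Finite.one_lt_card (α := k)) hc
  simp only [eulerObj]
  omega

lemma IsSES.eulerObj_right {X E Y : C} {ι : X ⟶ E} {π : E ⟶ Y} (h : IsSES ι π) (S : C)
    (hS : Subsingleton (Ext.{w} S X 2)) :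
    eulerObj.{t, w} k S E = eulerObj.{t, w} k S X + eulerObj.{t, w} k S Y := by
  have hc := h.card_covariant.{w} S hS
  have h₀ (A B : C) := Module.natCard_eq_pow_finrank (K := k) (V := (A ⟶ B))
  have h₁ (A B : C) := Module.natCard_eq_pow_finrank (K := k) (V := Ext.{w} A B 1)
  rw [h₀, h₀, h₀, h₁, h₁, h₁, ← pow_add, ← pow_add, ← pow_add, ← pow_add] at hc
  have := Nat.pow_right_injective (Finite.one_lt_card (α := k)) hc
  simp only [eulerObj]
  omega

/-- The Euler form depends on the dimension vector only. -/
lemma HasCompFactors.eulerObj_eq (hHered : ∀ X Y : C, Subsingleton (Ext.{w} X Y 2)) {M : C}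
    {d : SimpleClass C →₀ ℕ} (h : HasCompFactors M d) (S : C) :
    eulerObj.{t, w} k M S = d.sum (fun i n => (n : ℤ) * eulerObj.{t, w} k i.1.obj S) ∧
    eulerObj.{t, w} k S M = d.sum (fun i n => (n : ℤ) * eulerObj.{t, w} k S i.1.obj) := by
  refine rec_isSES (motive := fun M d =>
    eulerObj.{t, w} k M S = d.sum (fun i n => (n : ℤ) * eulerObj.{t, w} k i.1.obj S) ∧
    eulerObj.{t, w} k S M = d.sum (fun i n => (n : ℤ) * eulerObj.{t, w} k S i.1.obj)) ?_ ?_ h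
  · intro M hM
    have h0 : IsSES (0 : M ⟶ M) (0 : M ⟶ M) := by
      have : Epi (0 : M ⟶ M) := ⟨fun _ _ _ => hM.eq_of_src _ _⟩
      have : Mono (0 : M ⟶ M) := ⟨fun _ _ _ => hM.eq_of_tgt _ _⟩
      exact IsSES.of_lift (by simp) fun t _ => ⟨0, hM.eq_of_tgt _ _⟩
    have h1 := h0.eulerObj_left k hHom hExt S (hHered _ _)
    have h2 := h0.eulerObj_right k hHom hExt S (hHered _ _)
    simp only [Finsupp.sum_zero_index]
    omega
  · intro L M d i f c hfc _ ih
    rw [hfc.eulerObj_left k hHom hExt S (hHered _ _), hfc.eulerObj_right k hHom hExt S (hHered _ _),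
      Finsupp.sum_add_index' (by simp) (by intros; push_cast; ring),
      Finsupp.sum_add_index' (by simp) (by intros; push_cast; ring),
      Finsupp.sum_single_index (by simp), Finsupp.sum_single_index (by simp), ih.1, ih.2]
    simp

/-- The symmetric form of a dimension vector with a simple class is the symmetrized Euler form. -/
lemma HasCompFactors.form_eq (hHered : ∀ X Y : C, Subsingleton (Ext.{w} X Y 2)) {M : C}
    {d : SimpleClass C →₀ ℕ} (h : HasCompFactors M d) (i : SimpleClass C) :
    BorcherdsDatum.form (symEuler.{t, w} k) (BorcherdsDatum.toInt d) (Finsupp.single i 1) =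
      eulerObj.{t, w} k M i.1.obj + eulerObj.{t, w} k i.1.obj M := by
  rw [(h.eulerObj_eq k hHom hExt hHered i.1.obj).1, (h.eulerObj_eq k hHom hExt hHered i.1.obj).2,
    ← Finsupp.sum_add, BorcherdsDatum.form, BorcherdsDatum.toInt,
    Finsupp.sum_mapRange_index (by simp)]
  refine Finsupp.sum_congr fun j _ => ?_
  rw [Finsupp.sum_single_index (by simp)]
  simp only [symEuler, euler, eulerObj]
  ring

end EulerForm

/-! ### Hall numbers -/

section HallNumbers

open scoped Classical

variable {C : Type u} [Category.{v} C] [Abelian C]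

/-- A short exact sequence is a subobject together with parametrizations of the subobject and of the
quotient. -/
lemma bijective_subobject_ses (X E Y : C) : Function.Bijective
    (fun s : Σ U : {U : Subobject E // Nonempty ((U : C) ≅ X) ∧ Nonempty (cokernel U.arrow ≅ Y)},
        (X ≅ (U.1 : C)) × (cokernel U.1.arrow ≅ Y) =>
      (⟨(s.2.1.hom ≫ s.1.1.arrow, cokernel.π s.1.1.arrow ≫ s.2.2.hom),
        ((IsSES.cokernel s.1.1.arrow).comp_iso _).iso_comp _⟩ : SES X E Y)) := by
  constructor
  · rintro ⟨⟨U, hU⟩, φ, ψ⟩ ⟨⟨U', hU'⟩, φ', ψ'⟩ h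
    obtain ⟨h1, h2⟩ := Prod.ext_iff.1 (Subtype.ext_iff.1 h)
    dsimp only at h1 h2
    have hUU : U = U' := by
      refine Subobject.eq_of_comm (φ.symm ≪≫ φ') ?_
      rw [Iso.trans_hom, Iso.symm_hom, Category.assoc, ← h1, Iso.inv_hom_id_assoc]
    subst hUU
    rw [cancel_mono] at h1
    rw [cancel_epi] at h2
    obtain rfl := Iso.ext h1
    obtain rfl := Iso.ext h2
    rfl
  · rintro ⟨⟨ι, π⟩, h⟩
    dsimp only at h
    have := h.mono
    have h' : IsSES (Subobject.mk ι).arrow π := by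
      rw [← Subobject.underlyingIso_hom_comp_eq_mk]
      exact h.iso_comp _
    obtain ⟨ψ, hψ⟩ := (IsSES.cokernel (Subobject.mk ι).arrow).exists_iso_right h'
    exact ⟨⟨⟨Subobject.mk ι, ⟨Subobject.underlyingIso ι⟩, ⟨ψ⟩⟩, (Subobject.underlyingIso ι).symm, ψ⟩,
      Subtype.ext (Prod.ext (Subobject.underlyingIso_arrow ι) hψ)⟩

lemma hallNumber_mul_autCard (α β γ : IsoClass C) :
    hallNumber α β γ * (autCard β * autCard α) = Nat.card (SES β.obj γ.obj α.obj) := by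
  rw [← Nat.card_congr (Equiv.ofBijective _ (bijective_subobject_ses β.obj γ.obj α.obj)),
    hallNumber, autCard, autCard, ← Nat.card_prod, ← Nat.card_prod]
  refine Nat.card_congr ((Equiv.sigmaEquivProd _ _).symm.trans (Equiv.sigmaCongrRight fun U => ?_))
  exact Equiv.prodCongr (Iso.isoCongr (Iso.refl _) U.2.1.some.symm)
    (Iso.isoCongr U.2.2.some.symm (Iso.refl _))

/-- Isomorphic outer terms give equivalent sets of short exact sequences. -/
noncomputable def sesEquiv {X X' Y Y' : C} (E : C) (e : X ≅ X') (e' : Y ≅ Y') :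
    SES X E Y ≃ SES X' E Y' where
  toFun p := ⟨(e.inv ≫ p.1.1, p.1.2 ≫ e'.hom), (p.2.comp_iso _).iso_comp _⟩
  invFun p := ⟨(e.hom ≫ p.1.1, p.1.2 ≫ e'.inv), (p.2.comp_iso _).iso_comp _⟩
  left_inv p := Subtype.ext (Prod.ext (by simp) (by simp))
  right_inv p := Subtype.ext (Prod.ext (by simp) (by simp))

lemma finite_support_hallNumber [HasExt.{w} C] [∀ X Y : C, Finite (Ext.{w} X Y 1)]
    (α β : IsoClass C) : {γ | hallNumber α β γ ≠ 0}.Finite := by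
  refine (finite_middle_terms.{w} β.obj α.obj).subset fun γ hγ => ?_
  by_contra h
  have : IsEmpty (SES β.obj γ.obj α.obj) := ⟨fun p => h ⟨p.1.1, p.1.2, p.2⟩⟩
  refine hγ ?_
  rw [hallNumber, Nat.card_eq_zero]
  refine Or.inl ⟨fun U => ?_⟩
  exact this.elim ⟨(U.2.1.some.inv ≫ U.1.arrow, cokernel.π U.1.arrow ≫ U.2.2.some.hom),
    ((IsSES.cokernel U.1.arrow).comp_iso U.2.2.some.hom).iso_comp U.2.1.some.inv⟩

end HallNumbers

/-! ### Vanishing of orthogonal functions -/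

section Vanishing

open scoped Classical

variable {C : Type u} [Category.{v} C] [Abelian C] [HasExt.{w} C]
variable [∀ X Y : C, Finite (X ⟶ Y)]

attribute [local instance] homFintype extFintype

omit [HasExt.{w} C] in
/-- Orthogonality to Hall products of basis elements, in terms of short exact sequences. -/
lemma sum_card_ses_eq_zero (hC : IsLengthCategory C) (θ : SimpleClass C →₀ ℕ)
    (f : IsoClass C → ℝ) (𝓕 : Finset (IsoClass C)) (hdim : ∀ γ ∈ 𝓕, dimVec γ.obj = θ)
    (hcond : ∀ α β : IsoClass C, dimVec α.obj + dimVec β.obj = θ → dimVec α.obj ≠ θ →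
      dimVec β.obj ≠ θ → ∑ γ ∈ 𝓕, f γ * hallNumber α β γ / autCard γ = 0)
    (X Y : C) (hXY : dimVec Y + dimVec X = θ → dimVec X ≠ θ ∧ dimVec Y ≠ θ) :
    ∑ γ ∈ 𝓕, wt γ * f γ * Fintype.card (SES X γ.obj Y) = 0 := by
  by_cases h : dimVec Y + dimVec X = θ
  · obtain ⟨eX⟩ := IsoClass.nonempty_iso_obj X
    obtain ⟨eY⟩ := IsoClass.nonempty_iso_obj Y
    have h1 := hcond ⟦Y⟧ ⟦X⟧ (by rw [← dimVec_congr hC eX, ← dimVec_congr hC eY, h])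
      (by rw [← dimVec_congr hC eY]; exact (hXY h).2)
      (by rw [← dimVec_congr hC eX]; exact (hXY h).1)
    rw [← zero_mul ((autCard (⟦X⟧ : IsoClass C) : ℝ) * autCard (⟦Y⟧ : IsoClass C)), ← h1,
      Finset.sum_mul]
    refine Finset.sum_congr rfl fun γ _ => ?_
    rw [← Nat.card_eq_fintype_card, Nat.card_congr (sesEquiv γ.obj eX eY),
      ← hallNumber_mul_autCard, wt]
    push_cast
    ring
  · refine Finset.sum_eq_zero fun γ hγ => ?_
    have : IsEmpty (SES X γ.obj Y) :=
      ⟨fun p => h (by rw [← p.2.dimVec_eq hC, hdim γ hγ])⟩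
    simp

variable (k : Type t) [Field k] [Linear k C] [Finite k]
  (hHom : ∀ X Y : C, Module.Finite k (X ⟶ Y))
  (hExt : ∀ X Y : C, Module.Finite k (Ext.{w} X Y 1))
  (hHered : ∀ X Y : C, Subsingleton (Ext.{w} X Y 2))
include hExt

omit [∀ X Y : C, Finite (X ⟶ Y)] [Finite k] in
/-- Distinct simple objects that are orthogonal for the symmetric Euler form have no extensions. -/
lemma subsingleton_ext_of_symEuler_eq_zero {i j : SimpleClass C} (hij : i ≠ j)
    (h : symEuler.{t, w} k i j = 0) : Subsingleton (Ext.{w} i.1.obj j.1.obj 1) := by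
  have hz (i j : SimpleClass C) (hij : i ≠ j) : Module.finrank k (i.1.obj ⟶ j.1.obj) = 0 := by
    have hi := i.2
    have hj := j.2
    have : Subsingleton (i.1.obj ⟶ j.1.obj) := subsingleton_of_forall_eq 0 fun g => by
      by_contra hg
      have hm := mono_of_nonzero_from_simple hg
      have := isIso_of_mono_of_nonzero hg
      exact hij (SimpleClass.eq_of_iso (asIso g))
    exact Module.finrank_zero_of_subsingleton
  simp only [symEuler, euler, hz i j hij, hz j i hij.symm] at h
  have h0 : Module.finrank k (Ext.{w} i.1.obj j.1.obj 1) = 0 := by omega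
  have := hExt i.1.obj j.1.obj
  exact Module.finrank_zero_iff.1 h0

omit [Finite k] in
/-- The case of a dimension vector with disconnected support. -/
lemma eq_zero_of_not_connected (hC : IsLengthCategory C) (θ : SimpleClass C →₀ ℕ) (hθ : θ ≠ 0)
    (hconn : ¬ ((BorcherdsDatum.graph (symEuler.{t, w} (C := C) k)).induce
      {i | i ∈ θ.support}).Connected)
    (f : IsoClass C → ℝ) (𝓕 : Finset (IsoClass C)) (hf : ∀ γ ∉ 𝓕, f γ = 0)
    (hdim : ∀ γ ∈ 𝓕, dimVec γ.obj = θ)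
    (hcond : ∀ α β : IsoClass C, dimVec α.obj + dimVec β.obj = θ → dimVec α.obj ≠ θ →
      dimVec β.obj ≠ θ → ∑ γ ∈ 𝓕, f γ * hallNumber α β γ / autCard γ = 0) (γ : IsoClass C) :
    f γ = 0 := by
  by_cases hγ : γ ∈ 𝓕
  swap
  · exact hf γ hγ
  set G := (BorcherdsDatum.graph (symEuler.{t, w} (C := C) k)).induce {i | i ∈ θ.support}
  have hnonempty : Nonempty {i | i ∈ θ.support} :=
    (Finsupp.support_nonempty_iff.2 hθ).elim fun i hi => ⟨⟨i, hi⟩⟩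
  obtain ⟨i₀, i₁, hi⟩ : ∃ i₀ i₁, ¬ G.Reachable i₀ i₁ := by
    by_contra! h
    exact hconn { preconnected := h, nonempty := hnonempty }
  let P : Set (SimpleClass C) := {j | ∃ hj : j ∈ θ.support, G.Reachable i₀ ⟨j, hj⟩}
  have hsym (i j : SimpleClass C) (hi : i ∈ θ.support) (hiP : i ∉ P) (hjP : j ∈ P) :
      i ≠ j ∧ symEuler.{t, w} k i j = 0 ∧ symEuler.{t, w} k j i = 0 := by
    have hij : i ≠ j := fun h => hiP (h ▸ hjP)
    obtain ⟨hj, hr⟩ := hjP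
    have hadj : ¬ G.Adj ⟨j, hj⟩ ⟨i, hi⟩ := fun h => hiP ⟨hi, hr.trans h.reachable⟩
    simp only [G, SimpleGraph.comap_adj, BorcherdsDatum.graph, SimpleGraph.fromRel_adj,
      Function.Embedding.subtype_apply] at hadj
    push Not at hadj
    have := hadj hij.symm
    exact ⟨hij, this.2, this.1⟩
  have hcf : HasCompFactors γ.obj θ := hdim γ hγ ▸ hasCompFactors_dimVec hC γ.obj
  obtain ⟨X, Y, a, b, ι, π, h, hX, hY, ha, hb, hab⟩ :=
    hcf.exists_isSES_of_ext_eq_zero.{w} P fun i hi hiP j hj hjP =>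
      subsingleton_ext_of_symEuler_eq_zero k hExt (hsym i j hi hiP hjP).1
        (hsym i j hi hiP hjP).2.1
  have hsupp : ∀ i, i ∈ θ.support → i ∈ a.support ∨ i ∈ b.support := by
    intro i hi
    rw [hab, Finsupp.mem_support_iff, Finsupp.add_apply] at hi
    rw [Finsupp.mem_support_iff, Finsupp.mem_support_iff]
    omega
  have hsuppa : ∀ i ∈ a.support, i ∈ θ.support := by
    intro i hi
    rw [Finsupp.mem_support_iff] at hi
    rw [hab, Finsupp.mem_support_iff, Finsupp.add_apply]
    omega
  have ha0 : a ≠ 0 := by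
    rintro rfl
    have := (hsupp i₁.1 i₁.2).resolve_left (by simp)
    exact hi (hb _ this).2
  have hb0 : b ≠ 0 := by
    rintro rfl
    have := (hsupp i₀.1 i₀.2).resolve_right (by simp)
    exact ha _ this ⟨i₀.2, SimpleGraph.Reachable.refl _⟩
  have hsum := sum_card_ses_eq_zero hC θ f 𝓕 hdim hcond X Y (by
    rw [hX.dimVec_eq, hY.dimVec_eq, hab]
    exact fun _ => ⟨fun h => hb0 (by simpa using h), fun h => ha0 (by simpa using h)⟩)
  -- The extensions of `Y` by `X` split, so all of them are isomorphic to `γ`.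
  have hsub : Subsingleton (Ext.{w} Y X 1) :=
    hY.subsingleton_ext hX fun i hi j hj =>
      subsingleton_ext_of_symEuler_eq_zero k hExt
        (hsym j i (hsuppa j hj) (ha j hj) (hb i hi)).1.symm
        (hsym j i (hsuppa j hj) (ha j hj) (hb i hi)).2.2
  rw [Finset.sum_eq_single_of_mem γ hγ] at hsum
  · have hpos : (0 : ℝ) < Fintype.card (SES X γ.obj Y) :=
      Nat.cast_pos.2 (Fintype.card_pos_iff.2 ⟨⟨(ι, π), h⟩⟩)
    have := (mul_eq_zero.1 hsum).resolve_right hpos.ne'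
    exact (mul_eq_zero.1 this).resolve_left (wt_pos γ).ne'
  · intro γ' _ hne
    have : IsEmpty (SES X γ'.obj Y) := ⟨fun p => by
      obtain ⟨φ, -, -⟩ := p.2.exists_iso_of_extClass_eq h (Subsingleton.elim _ _)
      exact hne ((IsoClass.mk_obj γ').symm.trans (IsoClass.eq_of_iso_obj φ))⟩
    simp

variable [∀ X Y : C, Finite (Ext.{w} X Y 1)]

include hHom hHered

/-- The case of a simple object `i` with `(θ, i) > 0`. -/
lemma eq_zero_of_form_pos (hC : IsLengthCategory C) (θ : SimpleClass C →₀ ℕ)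
    (hsimple : ∀ i, θ ≠ Finsupp.single i 1) (i : SimpleClass C)
    (hi : 0 < BorcherdsDatum.form (symEuler.{t, w} k) (BorcherdsDatum.toInt θ)
      (Finsupp.single i 1))
    (f : IsoClass C → ℝ) (𝓕 : Finset (IsoClass C)) (hf : ∀ γ ∉ 𝓕, f γ = 0)
    (hdim : ∀ γ ∈ 𝓕, dimVec γ.obj = θ)
    (hcond : ∀ α β : IsoClass C, dimVec α.obj + dimVec β.obj = θ → dimVec α.obj ≠ θ →
      dimVec β.obj ≠ θ → ∑ γ ∈ 𝓕, f γ * hallNumber α β γ / autCard γ = 0) (γ : IsoClass C) :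
    f γ = 0 := by
  have hS := i.2
  have hq : (1 : ℝ) < Nat.card k := Nat.one_lt_cast.2 Finite.one_lt_card
  have hcf (γ : IsoClass C) (hγ : γ ∈ 𝓕) : HasCompFactors γ.obj θ :=
    hdim γ hγ ▸ hasCompFactors_dimVec hC γ.obj
  have hratio (X Y : C) : (Fintype.card (Ext.{w} X Y 1) : ℝ) / Fintype.card (X ⟶ Y) =
      (Nat.card k : ℝ) ^ (-eulerObj.{t, w} k X Y) := by
    rw [← Nat.card_eq_fintype_card, ← Nat.card_eq_fintype_card,
      Module.natCard_eq_pow_finrank (K := k) (V := Ext.{w} X Y 1),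
      Module.natCard_eq_pow_finrank (K := k) (V := (X ⟶ Y)), eulerObj, neg_sub,
      zpow_sub₀ (by positivity), zpow_natCast, zpow_natCast]
    push_cast
    rfl
  have hne : dimVec i.1.obj = Finsupp.single i 1 := (HasCompFactors.simple i).dimVec_eq
  obtain h𝓕 | ⟨γ₀, hγ₀⟩ := 𝓕.eq_empty_or_nonempty
  · exact hf γ (by simp [h𝓕])
  refine eq_zero_of_orthogonal.{w} i.1.obj f 𝓕 hf (hHered _ _)
    (fun A => sum_card_ses_eq_zero hC θ f 𝓕 hdim hcond _ _ fun h => ?_)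
    (fun A => sum_card_ses_eq_zero hC θ f 𝓕 hdim hcond _ _ fun h => ?_)
    ((Nat.card k : ℝ) ^ (-eulerObj.{t, w} k γ₀.obj i.1.obj))
    ((Nat.card k : ℝ) ^ (-eulerObj.{t, w} k i.1.obj γ₀.obj))
    (fun γ hγ => ?_) (fun γ hγ => ?_) ?_ γ
  · rw [hne] at h ⊢
    refine ⟨(hsimple i).symm, fun h' => ?_⟩
    rw [h'] at h
    simp at h
  · rw [hne] at h ⊢
    refine ⟨fun h' => ?_, (hsimple i).symm⟩
    rw [h'] at h
    simp at h
  · rw [hratio, ((hcf γ hγ).eulerObj_eq k hHom hExt hHered _).1,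
      ((hcf γ₀ hγ₀).eulerObj_eq k hHom hExt hHered _).1]
  · rw [hratio, ((hcf γ hγ).eulerObj_eq k hHom hExt hHered _).2,
      ((hcf γ₀ hγ₀).eulerObj_eq k hHom hExt hHered _).2]
  · rw [← zpow_add₀ (by positivity)]
    refine zpow_lt_one_of_neg₀ hq ?_
    rw [(hcf γ₀ hγ₀).form_eq k hHom hExt hHered i] at hi
    omega

/-- For `θ` outside the fundamental region, a function on the classes of dimension vector `θ` that is
orthogonal to all proper Hall products vanishes. -/
lemma eq_zero_of_hall_orthogonal (hC : IsLengthCategory C) (θ : SimpleClass C →₀ ℕ) (hθ : θ ≠ 0)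
    (hθ' : θ ∉ BorcherdsDatum.fundamentalRegion (symEuler.{t, w} (C := C) k) ∪
      BorcherdsDatum.imagMultiples (symEuler.{t, w} (C := C) k))
    (hsimple : ∀ i, θ ≠ Finsupp.single i 1)
    (g : IsoClass C → ℂ) (𝓕 : Finset (IsoClass C)) (hg : ∀ γ ∉ 𝓕, g γ = 0)
    (hdim : ∀ γ ∈ 𝓕, dimVec γ.obj = θ)
    (hcond : ∀ α β : IsoClass C, dimVec α.obj + dimVec β.obj = θ → dimVec α.obj ≠ θ →
      dimVec β.obj ≠ θ → ∑ γ ∈ 𝓕, g γ * hallNumber α β γ / autCard γ = 0) (γ : IsoClass C) :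
    g γ = 0 := by
  have hreal (f : IsoClass C → ℝ) (hf : ∀ γ ∉ 𝓕, f γ = 0)
      (hcond : ∀ α β : IsoClass C, dimVec α.obj + dimVec β.obj = θ → dimVec α.obj ≠ θ →
        dimVec β.obj ≠ θ → ∑ γ ∈ 𝓕, f γ * hallNumber α β γ / autCard γ = 0) : f γ = 0 := by
    rw [Set.mem_union, not_or] at hθ'
    by_cases hi : ∃ i, 0 < BorcherdsDatum.form (symEuler.{t, w} (C := C) k)
        (BorcherdsDatum.toInt θ) (Finsupp.single i 1)
    · obtain ⟨i, hi⟩ := hi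
      exact eq_zero_of_form_pos k hHom hExt hHered hC θ hsimple i hi f 𝓕 hf hdim hcond γ
    · push Not at hi
      refine eq_zero_of_not_connected k hExt hC θ hθ (fun hconn => ?_) f 𝓕 hf hdim hcond γ
      exact hθ'.1 ⟨⟨hθ, fun i _ => hi i, hconn⟩, hθ'.2⟩
  have hre := hreal (fun γ => (g γ).re) (fun γ hγ => by simp [hg γ hγ]) fun α β h h₁ h₂ => by
    have := congrArg Complex.re (hcond α β h h₁ h₂)
    rw [Complex.re_sum, Complex.zero_re] at this
    rw [← this]
    refine Finset.sum_congr rfl fun γ _ => ?_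
    rw [Complex.div_natCast_re, Complex.mul_re]
    simp
  have him := hreal (fun γ => (g γ).im) (fun γ hγ => by simp [hg γ hγ]) fun α β h h₁ h₂ => by
    have := congrArg Complex.im (hcond α β h h₁ h₂)
    rw [Complex.im_sum, Complex.zero_im] at this
    rw [← this]
    refine Finset.sum_congr rfl fun γ _ => ?_
    rw [Complex.div_natCast_im, Complex.mul_im]
    simp
  exact Complex.ext hre him

end Vanishing

/-! ### Pairings and products in the Ringel-Hall algebras -/

section Pairing

open scoped Classical

variable (k : Type t) [Field k] {C : Type u} [Category.{v} C] [Abelian C] [Linear k C]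
  [HasExt.{w} C]

lemma symForm_zero_left (ν : SimpleClass C →₀ ℤ) : symForm.{t, w} k 0 ν = 0 := by
  simp [symForm, BorcherdsDatum.form]

lemma symForm_zero_right (μ : SimpleClass C →₀ ℤ) : symForm.{t, w} k μ 0 = 0 := by
  simp [symForm, BorcherdsDatum.form]

omit [HasExt.{w} C] in
lemma apply_ne_zero_of_mem_hPos {θ : SimpleClass C →₀ ℕ} {x : HallPos C} (hx : x ∈ hPos θ)
    {p : (SimpleClass C →₀ ℤ) × IsoClass C} (hp : x p ≠ 0) :
    p.1 = 0 ∧ dimVec p.2.obj = θ := by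
  induction hx using Submodule.span_induction with
  | mem x hx =>
    obtain ⟨α, hα, rfl⟩ := hx
    rw [uPos, Finsupp.single_apply_ne_zero] at hp
    rw [hp.1]
    exact ⟨rfl, hα⟩
  | zero => simp at hp
  | add x y _ _ hx hy =>
    by_cases h : x p = 0
    · exact hy fun h' => hp (by simp [h, h'])
    · exact hx h
  | smul c x _ hx => exact hx fun h => hp (by simp [h])

lemma pairing_single_single (α β : IsoClass C) (c d : ℂ) :
    pairing.{t, w} k (Finsupp.single (0, α) c) (Finsupp.single (0, β) d) =
      if α = β then c * d / autCard α else 0 := by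
  simp only [pairing, Finsupp.linearCombination_single, LinearMap.smul_apply, symForm_zero_left,
    symForm_zero_right, sub_zero, neg_zero, add_zero, zpow_zero, one_mul, smul_eq_mul]
  split_ifs
  · ring
  · simp

lemma pairing_single_right {θ : SimpleClass C →₀ ℕ} {x : HallPos C} (hx : x ∈ hPos θ)
    (γ : IsoClass C) (c : ℂ) :
    pairing.{t, w} k x (Finsupp.single (0, γ) c) = x (0, γ) * c / autCard γ := by
  induction hx using Submodule.span_induction with
  | mem x hx =>
    obtain ⟨α, -, rfl⟩ := hx
    rw [uPos, pairing_single_single, Finsupp.single_apply]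
    by_cases h : α = γ
    · simp [h]
    · simp [h]
  | zero => simp
  | add x y _ _ hx hy =>
    rw [map_add, LinearMap.add_apply, hx, hy, Finsupp.add_apply]
    ring
  | smul a x _ hx =>
    rw [map_smul, LinearMap.smul_apply, hx, Finsupp.smul_apply, smul_eq_mul, smul_eq_mul]
    ring

lemma pairing_single_left {θ : SimpleClass C →₀ ℕ} {y : HallNeg C} (hy : y ∈ hNeg θ)
    (γ : IsoClass C) (c : ℂ) :
    pairing.{t, w} k (Finsupp.single (0, γ) c) y = y (0, γ) * c / autCard γ := by
  induction hy using Submodule.span_induction with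
  | mem x hx =>
    obtain ⟨α, -, rfl⟩ := hx
    rw [uNeg, pairing_single_single, Finsupp.single_apply]
    by_cases h : γ = α
    · simp [h]
    · simp [h, Ne.symm h]
  | zero => simp
  | add x y _ _ hx hy =>
    rw [map_add, hx, hy, Finsupp.add_apply]
    ring
  | smul a x _ hx =>
    rw [map_smul, hx, Finsupp.smul_apply, smul_eq_mul, smul_eq_mul]
    ring

lemma mulPos_uPos_uPos (α β : IsoClass C) :
    mulPos.{t, w} k (uPos α) (uPos β) = vParam k ^ euler.{t, w} k α β •
      ∑ᶠ γ : IsoClass C, (Finsupp.single (0, γ) (hallNumber α β γ : ℂ) : HallPos C) := by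
  simp [mulPos, uPos, Finsupp.linearCombination_single, symForm_zero_left]

lemma mulNeg_uNeg_uNeg (α β : IsoClass C) :
    mulNeg.{t, w} k (uNeg α) (uNeg β) = vParam k ^ euler.{t, w} k α β •
      ∑ᶠ γ : IsoClass C, (Finsupp.single (0, γ) (hallNumber α β γ : ℂ) : HallNeg C) := by
  simp [mulNeg, uNeg, Finsupp.linearCombination_single, symForm_zero_left]

lemma vParam_ne_zero [Finite k] : vParam k ≠ 0 :=
  Complex.ofReal_ne_zero.2 (Real.sqrt_pos.2 (Nat.cast_pos.2 Nat.card_pos)).ne'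

variable [Finite k] [∀ X Y : C, Finite (X ⟶ Y)] [∀ X Y : C, Finite (Ext.{w} X Y 1)]

omit [Finite k] [∀ X Y : C, Finite (X ⟶ Y)] in
/-- A linear functional that takes the value `x_γ c / a_γ` on `c u_γ` takes the value
`∑_γ x_γ g^γ_{αβ} / a_γ` on `∑_γ g^γ_{αβ} u_γ`. -/
lemma map_finsum_hallNumber (ℓ : (((SimpleClass C →₀ ℤ) × IsoClass C) →₀ ℂ) →ₗ[ℂ] ℂ)
    (x : IsoClass C → ℂ) (𝓕 : Finset (IsoClass C)) (hx : ∀ γ ∉ 𝓕, x γ = 0)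
    (hℓ : ∀ γ c, ℓ (Finsupp.single (0, γ) c) = x γ * c / autCard γ) (α β : IsoClass C) :
    ℓ (∑ᶠ γ : IsoClass C, Finsupp.single (0, γ) (hallNumber α β γ : ℂ)) =
      ∑ γ ∈ 𝓕, x γ * hallNumber α β γ / autCard γ := by
  rw [map_finsum ℓ]
  · simp only [hℓ]
    refine finsum_eq_sum_of_support_subset _ fun γ hγ => ?_
    by_contra h
    exact hγ (by simp [hx γ h])
  · refine (finite_support_hallNumber.{w} α β).subset fun γ hγ h => hγ ?_
    simp [h]

variable (hHom : ∀ X Y : C, Module.Finite k (X ⟶ Y))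
  (hExt : ∀ X Y : C, Module.Finite k (Ext.{w} X Y 1))
  (hHered : ∀ X Y : C, Subsingleton (Ext.{w} X Y 2))
include hHom hExt hHered

/-- An element `x` of degree `θ` vanishes if a functional representing it, in the sense that
`c u_γ` is sent to `x_γ c / a_γ`, vanishes on all `u_γ` (for `θ` simple) or on all proper
products `u_α u_β` (for `θ` not simple). -/
lemma eq_zero_of_functional (hC : IsLengthCategory C) (θ : SimpleClass C →₀ ℕ) (hθ : θ ≠ 0)
    (hθ' : θ ∉ BorcherdsDatum.fundamentalRegion (symEuler.{t, w} (C := C) k) ∪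
      BorcherdsDatum.imagMultiples (symEuler.{t, w} (C := C) k))
    {x : HallPos C} (hx : x ∈ hPos θ)
    (ℓ : (((SimpleClass C →₀ ℤ) × IsoClass C) →₀ ℂ) →ₗ[ℂ] ℂ)
    (hℓ : ∀ γ c, ℓ (Finsupp.single (0, γ) c) = x (0, γ) * c / autCard γ)
    (hsimple : (∃ i, θ = Finsupp.single i 1) → ∀ γ : IsoClass C, dimVec γ.obj = θ →
      ℓ (Finsupp.single (0, γ) 1) = 0)
    (hprod : (¬ ∃ i, θ = Finsupp.single i 1) → ∀ α β : IsoClass C,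
      dimVec α.obj + dimVec β.obj = θ → dimVec α.obj ≠ θ → dimVec β.obj ≠ θ →
      vParam k ^ euler.{t, w} k α β *
        ℓ (∑ᶠ γ : IsoClass C, Finsupp.single (0, γ) (hallNumber α β γ : ℂ)) = 0) :
    x = 0 := by
  suffices h : ∀ γ : IsoClass C, x (0, γ) = 0 by
    ext ⟨μ, γ⟩
    by_contra hp
    obtain ⟨rfl, -⟩ := apply_ne_zero_of_mem_hPos hx hp
    exact hp (h γ)
  by_cases hs : ∃ i, θ = Finsupp.single i 1
  · intro γ
    by_contra hp
    have h := hsimple hs γ (apply_ne_zero_of_mem_hPos hx hp).2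
    rw [hℓ, mul_one] at h
    exact div_ne_zero hp (Nat.cast_ne_zero.2 (autCard_pos γ).ne') h
  · have h𝓕 : ∀ γ ∉ x.support.image Prod.snd, x (0, γ) = 0 := fun γ hγ => by
      by_contra h
      exact hγ (Finset.mem_image.2 ⟨(0, γ), Finsupp.mem_support_iff.2 h, rfl⟩)
    refine eq_zero_of_hall_orthogonal k hHom hExt hHered hC θ hθ hθ'
      (fun i hi => hs ⟨i, hi⟩) (fun γ => x (0, γ)) (x.support.image Prod.snd) h𝓕
      (fun γ hγ => ?_) (fun α β h h₁ h₂ => ?_)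
    · obtain ⟨p, hp, rfl⟩ := Finset.mem_image.1 hγ
      exact (apply_ne_zero_of_mem_hPos hx (Finsupp.mem_support_iff.1 hp)).2
    · rw [← map_finsum_hallNumber.{w} ℓ _ _ h𝓕 hℓ]
      exact (mul_eq_zero.1 (hprod hs α β h h₁ h₂)).resolve_left
        (zpow_ne_zero _ (vParam_ne_zero k))

end Pairing

end RingelHall

open RingelHall

theorem mainTheorem7 (k : Type t) [Field k] [Finite k]
    (C : Type u) [Category.{v} C] [Abelian C] [Linear k C] [HasExt.{w} C]
    (hHom : ∀ X Y : C, Module.Finite k (X ⟶ Y))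
    (hExt : ∀ X Y : C, Module.Finite k (Ext.{w} X Y 1))
    (hHered : ∀ (X Y : C) (n : ℕ), 2 ≤ n → Subsingleton (Ext.{w} X Y n))
    (hLength : RingelHall.IsLengthCategory C)
    (θ : RingelHall.SimpleClass C →₀ ℕ) (hθ : θ ≠ 0)
    (hθ' : θ ∉ BorcherdsDatum.fundamentalRegion (RingelHall.symEuler.{t, w} (C := C) k) ∪
      BorcherdsDatum.imagMultiples (RingelHall.symEuler.{t, w} (C := C) k)) :
    RingelHall.LPos.{t, w} k θ = ⊥ ∧ RingelHall.LNeg.{t, w} k θ = ⊥ := by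
  have (X Y : C) : Finite (X ⟶ Y) := Module.finite_of_finite k
  have (X Y : C) : Finite (Ext.{w} X Y 1) := Module.finite_of_finite k
  have hHered' (X Y : C) : Subsingleton (Ext.{w} X Y 2) := hHered X Y 2 le_rfl
  rw [Submodule.eq_bot_iff, Submodule.eq_bot_iff]
  constructor
  · rintro x ⟨hx, hx'⟩
    refine eq_zero_of_functional k hHom hExt hHered' hLength θ hθ hθ' hx (pairing.{t, w} k x)
      (pairing_single_right k hx) (fun hs γ hγ => hx' _ ?_) (fun hs α β h h₁ h₂ => ?_)
    · rw [XiNeg, if_pos (.inr hs)]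
      exact Submodule.subset_span ⟨γ, hγ, rfl⟩
    · rw [← smul_eq_mul, ← map_smul, ← mulNeg_uNeg_uNeg]
      refine hx' _ ?_
      rw [XiNeg, if_neg (not_or.2 ⟨hθ, hs⟩)]
      exact Submodule.subset_span ⟨_, _, h, h₁, h₂, uNeg α, Submodule.subset_span ⟨α, rfl, rfl⟩,
        uNeg β, Submodule.subset_span ⟨β, rfl, rfl⟩, rfl⟩
  · rintro y ⟨hy, hy'⟩
    refine eq_zero_of_functional k hHom hExt hHered' hLength θ hθ hθ' hy
      ((pairing.{t, w} k).flip y) (pairing_single_left k hy) (fun hs γ hγ => hy' _ ?_)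
      (fun hs α β h h₁ h₂ => ?_)
    · rw [XiPos, if_pos (.inr hs)]
      exact Submodule.subset_span ⟨γ, hγ, rfl⟩
    · rw [← smul_eq_mul, ← map_smul, ← mulPos_uPos_uPos, LinearMap.flip_apply]
      refine hy' _ ?_
      rw [XiPos, if_neg (not_or.2 ⟨hθ, hs⟩)]
      exact Submodule.subset_span ⟨_, _, h, h₁, h₂, uPos α, Submodule.subset_span ⟨α, rfl, rfl⟩,
        uPos β, Submodule.subset_span ⟨β, rfl, rfl⟩, rfl⟩
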